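/- Let $q\in\mathbb C^\times$ not be a root of unity (e.g. $0<q<1$) and let $U_q(\mathfrak{sl}_2)$ be the $\mathbb C$-algebra generated by $E,F,K^{\pm1}$ with relations $KEK^{-1}=q^2E$, $KFK^{-1}=q^{-2}F$, $EF-FE=\frac{K-K^{-1}}{q-q^{-1}}$. For $c_0\in\mathbb C$ let $\mathcal A=U_q(\mathfrak{sl}_2)/(C-c_0)$, where $C=FE+\frac{qK+q^{-1}K^{-1}}{(q-q^{-1})^2}$. Let $\mathcal A_+\subset\mathcal A$ be the subalgebra generated by $F$, $K^{-1}$, $EK^{-1}$, filtered by giving each of these generators degree $2$: $\mathcal A_{\le i}$ is the span of the words of degree at most $i$ in them. For $t\in\mathbb C^\times$ let $g_t$ be the automorphism of $\mathcal A$ with $g_t(E)=tE$, $g_t(F)=t^{-1}F$, $g_t(K)=K$; a linear map $T:\mathcal A\to\mathbb C$ is a $g_t$-twisted trace if $T(ab)=T(b\,g_t(a))$ for all $a,b\in\mathcal A$. **Proposition.** (a) For every $c_0\in\mathbb C$ there is a $g_{q^{-2}}$-twisted trace $T$ on $\mathcal A$ whose restriction to $\mathcal A_+$ is nonzero. Any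 such $T$ is invariant under the adjoint action of $U_q(\mathfrak{sl}_2)$, i.e. $T(KaK^{-1})=T(a)$, $T(Ea-KaK^{-1}E)=0$ and $T((Fa-aF)K)=0$ for all $a\in\mathcal A$, and the restriction to $\mathcal A_+$ of any $g_{q^{-2}}$-twisted trace on $\mathcal A$ is a scalar multiple of $T|_{\mathcal A_+}$. (b) For every $c_0$ and every $T$ as in (a), consider the bilinear form $(a,b)=T(ab)$ on $\mathcal A_+$. The following are equivalent: 1. the restriction of $(\cdot,\cdot)$ to $\mathcal A_{\le i}$ is nondegenerate for all $i\ge 0$; 2. $(\cdot,\cdot)$ has trivial kernel on $\mathcal A_+$ (equivalently: trivial left kernel; trivial right kernel); 3. $\mathcal A$ has no nonzero finite-dimensional representations. (c) There is a countable set $S\subset\mathbb C$ (depending only on $q$) such that for every $c_0\in\mathbb C\setminus S$ and every $T$ as in (a), the form $(\cdot,\cdot)$ is nondegenerate on $\mathcal A_{\le i}$ for all $i$, and $T$ gives a nondegenerate short star-product on the associated graded algebra $\operatorname{gr}\mathcal A_+=\bigoplus_k A_k$, $A_k=\mathcal A_{\le k}/\mathcal A_{\le k-1}$. That is, there is a unique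 linear isomorphism $\varphi:\operatorname{gr}\mathcal A_+\to\mathcal A_+$ sending each $a\in A_k$ to a lift of $a$ in $\mathcal A_{\le k}$ with $T(b\varphi(a))=T(\varphi(a)b)=0$ for all $b\in\mathcal A_{\le k-1}$; the associative product $x*y=\varphi^{-1}(\varphi(x)\varphi(y))$ satisfies, for $a\in A_k$, $b\in A_m$, $a*b=\sum_{i=0}^{\min(k,m)}c_i(a,b)$ with $c_i(a,b)\in A_{k+m-2i}$ and $c_0(a,b)=ab$; for every $k$ the form $A_k\times A_k\to A_0$, $(a,b)\mapsto CT(a*b)$ ($CT$ is the degree-zero component) is nondegenerate; and $T(\varphi(x))=T(\varphi(CT(x)))$ for all $x$. -/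

import Mathlib

open scoped DirectSum

noncomputable section

/-! ## The quantum group `U_q(sl₂)` and its central reductions -/

namespace QSl2

/-- The generators `E`, `F`, `K`, `K⁻¹` of `U_q(sl₂)`. -/
inductive Gen : Type
  | E | F | K | Kinv

/-- A generator, as an element of the free algebra. -/
abbrev gen (x : Gen) : FreeAlgebra ℂ Gen := FreeAlgebra.ι ℂ x

/-- The defining relations of `U_q(sl₂)`. -/
inductive Rel (q : ℂˣ) : FreeAlgebra ℂ Gen → FreeAlgebra ℂ Gen → Prop
  | K_mul_Kinv : Rel q (gen .K * gen .Kinv) 1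
  | Kinv_mul_K : Rel q (gen .Kinv * gen .K) 1
  | K_E : Rel q (gen .K * gen .E * gen .Kinv) ((q : ℂ) ^ 2 • gen .E)
  | K_F : Rel q (gen .K * gen .F * gen .Kinv) (((q : ℂ) ^ 2)⁻¹ • gen .F)
  | E_F : Rel q (gen .E * gen .F - gen .F * gen .E)
      (((q : ℂ) - (q : ℂ)⁻¹)⁻¹ • (gen .K - gen .Kinv))

/-- The algebra `U_q(sl₂)` over `ℂ`. -/
def Uq (q : ℂˣ) : Type := RingQuot (Rel q)

instance (q : ℂˣ) : Ring (Uq q) := inferInstanceAs (Ring (RingQuot (Rel q)))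

instance (q : ℂˣ) : Algebra ℂ (Uq q) := inferInstanceAs (Algebra ℂ (RingQuot (Rel q)))

/-- The quotient map from the free algebra to `U_q(sl₂)`. -/
def Uq.mk (q : ℂˣ) : FreeAlgebra ℂ Gen →ₐ[ℂ] Uq q := RingQuot.mkAlgHom ℂ (Rel q)

theorem Uq.mk_rel {q : ℂˣ} {x y : FreeAlgebra ℂ Gen} (h : Rel q x y) : Uq.mk q x = Uq.mk q y :=
  RingQuot.mkAlgHom_rel ℂ h

/-- The universal property of `U_q(sl₂)`. -/
def Uq.lift (q : ℂˣ) {B : Type*} [Ring B] [Algebra ℂ B] (f : FreeAlgebra ℂ Gen →ₐ[ℂ] B)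
    (hf : ∀ ⦃x y⦄, Rel q x y → f x = f y) : Uq q →ₐ[ℂ] B :=
  RingQuot.liftAlgHom ℂ ⟨f, hf⟩

theorem Uq.lift_mk (q : ℂˣ) {B : Type*} [Ring B] [Algebra ℂ B] (f : FreeAlgebra ℂ Gen →ₐ[ℂ] B)
    (hf : ∀ ⦃x y⦄, Rel q x y → f x = f y) (x : FreeAlgebra ℂ Gen) :
    Uq.lift q f hf (Uq.mk q x) = f x :=
  RingQuot.liftAlgHom_mkAlgHom_apply ℂ f hf x

/-- The image of a generator in `U_q(sl₂)`. -/
def Uq.of (q : ℂˣ) (x : Gen) : Uq q := Uq.mk q (gen x)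

/-- The Casimir element `C = FE + (Kq + K⁻¹q⁻¹) / (q - q⁻¹)²`. -/
def casimir (q : ℂˣ) : Uq q :=
  Uq.of q .F * Uq.of q .E +
    (((q : ℂ) - (q : ℂ)⁻¹) ^ 2)⁻¹ • ((q : ℂ) • Uq.of q .K + (q : ℂ)⁻¹ • Uq.of q .Kinv)

/-- The relation `C = c₀`. -/
inductive CentralRel (q : ℂˣ) (c₀ : ℂ) : Uq q → Uq q → Prop
  | casimir : CentralRel q c₀ (casimir q) (algebraMap ℂ (Uq q) c₀)

/-- The central reduction `𝒜 = U_q(sl₂) / (C - c₀)`. -/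
def A (q : ℂˣ) (c₀ : ℂ) : Type := RingQuot (CentralRel q c₀)

instance (q : ℂˣ) (c₀ : ℂ) : Ring (A q c₀) := inferInstanceAs (Ring (RingQuot (CentralRel q c₀)))

instance (q : ℂˣ) (c₀ : ℂ) : Algebra ℂ (A q c₀) :=
  inferInstanceAs (Algebra ℂ (RingQuot (CentralRel q c₀)))

/-- The quotient map `U_q(sl₂) → 𝒜`. -/
def A.mk (q : ℂˣ) (c₀ : ℂ) : Uq q →ₐ[ℂ] A q c₀ := RingQuot.mkAlgHom ℂ (CentralRel q c₀)

theorem A.mk_casimir (q : ℂˣ) (c₀ : ℂ) :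
    A.mk q c₀ (casimir q) = A.mk q c₀ (algebraMap ℂ (Uq q) c₀) :=
  RingQuot.mkAlgHom_rel ℂ CentralRel.casimir

/-- The universal property of `𝒜`. -/
def A.lift (q : ℂˣ) (c₀ : ℂ) {B : Type*} [Ring B] [Algebra ℂ B] (f : Uq q →ₐ[ℂ] B)
    (hf : ∀ ⦃x y⦄, CentralRel q c₀ x y → f x = f y) : A q c₀ →ₐ[ℂ] B :=
  RingQuot.liftAlgHom ℂ ⟨f, hf⟩

theorem A.lift_mk (q : ℂˣ) (c₀ : ℂ) {B : Type*} [Ring B] [Algebra ℂ B] (f : Uq q →ₐ[ℂ] B)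
    (hf : ∀ ⦃x y⦄, CentralRel q c₀ x y → f x = f y) (x : Uq q) :
    A.lift q c₀ f hf (A.mk q c₀ x) = f x :=
  RingQuot.liftAlgHom_mkAlgHom_apply ℂ f hf x

/-- The image of a generator in `𝒜`. -/
def A.of (q : ℂˣ) (c₀ : ℂ) (x : Gen) : A q c₀ := A.mk q c₀ (Uq.of q x)

/-- `g_t` on generators: `E ↦ tE`, `F ↦ t⁻¹F`, `K ↦ K`, `K⁻¹ ↦ K⁻¹`. -/
def gWeight (t : ℂˣ) : Gen → ℂ
  | .E => (t : ℂ)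
  | .F => (t : ℂ)⁻¹
  | .K => 1
  | .Kinv => 1

/-- `g_t` as an endomorphism of `U_q(sl₂)`. -/
def gUq (q t : ℂˣ) : Uq q →ₐ[ℂ] Uq q :=
  Uq.lift q (FreeAlgebra.lift ℂ fun x => gWeight t x • Uq.of q x) (by
    have ht : (t : ℂ) ≠ 0 := t.ne_zero
    intro x y h
    have hk := Uq.mk_rel h
    cases h <;>
      simp only [map_mul, map_sub, map_smul, map_one, gen, FreeAlgebra.lift_ι_apply, gWeight,
        Uq.of, one_smul, smul_mul_assoc, mul_smul_comm] at hk ⊢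
    · exact hk
    · exact hk
    · rw [hk, smul_comm]
    · rw [hk, smul_comm]
    · simp only [smul_smul, mul_inv_cancel₀ ht, inv_mul_cancel₀ ht, one_smul]
      exact hk)

theorem gUq_of (q t : ℂˣ) (x : Gen) : gUq q t (Uq.of q x) = gWeight t x • Uq.of q x := by
  rw [gUq, Uq.of, Uq.lift_mk, gen, FreeAlgebra.lift_ι_apply]; rfl

/-- The automorphism `g_t` of `𝒜`, with `g_t(E) = tE`, `g_t(F) = t⁻¹F`, `g_t(K) = K`. -/
def g (q : ℂˣ) (c₀ : ℂ) (t : ℂˣ) : A q c₀ →ₐ[ℂ] A q c₀ :=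
  A.lift q c₀ ((A.mk q c₀).comp (gUq q t)) (by
    have ht : (t : ℂ) ≠ 0 := t.ne_zero
    intro x y h
    cases h
    have : gUq q t (casimir q) = casimir q := by
      simp only [casimir, map_add, map_mul, map_smul, gUq_of, gWeight, smul_mul_assoc,
        mul_smul_comm, smul_smul, mul_inv_cancel₀ ht, one_smul]
    simp only [AlgHom.comp_apply, this, A.mk_casimir, AlgHom.commutes])

theorem g_of (q : ℂˣ) (c₀ : ℂ) (t : ℂˣ) (x : Gen) :
    g q c₀ t (A.of q c₀ x) = gWeight t x • A.of q c₀ x := by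
  rw [g, A.of, A.lift_mk, AlgHom.comp_apply, gUq_of, map_smul]

/-- `T` is a `g_t`-twisted trace on `𝒜`: `T(ab) = T(b g_t(a))`. -/
def IsTwistedTrace (q : ℂˣ) (c₀ : ℂ) (t : ℂˣ) (T : A q c₀ →ₗ[ℂ] ℂ) : Prop :=
  ∀ a b : A q c₀, T (a * b) = T (b * g q c₀ t a)

/-- `T` is invariant with respect to the adjoint action of `U_q(sl₂)` on `𝒜`, that is,
`T(ad(X)a) = ε(X)T(a)` for the generators `X = K, E, F`, where `ad(K)a = KaK⁻¹`,
`ad(E)a = Ea - KaK⁻¹E`, `ad(F)a = (Fa - aF)K` and `ε(K) = 1`, `ε(E) = ε(F) = 0`. -/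
def IsAdInvariant (q : ℂˣ) (c₀ : ℂ) (T : A q c₀ →ₗ[ℂ] ℂ) : Prop :=
  ∀ a : A q c₀,
    T (A.of q c₀ .K * a * A.of q c₀ .Kinv) = T a ∧
    T (A.of q c₀ .E * a - A.of q c₀ .K * a * A.of q c₀ .Kinv * A.of q c₀ .E) = 0 ∧
    T ((A.of q c₀ .F * a - a * A.of q c₀ .F) * A.of q c₀ .K) = 0

/-- The generators `F`, `K⁻¹`, `EK⁻¹` of `𝒜₊`. -/
def plusGens (q : ℂˣ) (c₀ : ℂ) : Set (A q c₀) :=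
  {A.of q c₀ .F, A.of q c₀ .Kinv, A.of q c₀ .E * A.of q c₀ .Kinv}

/-- The subalgebra `𝒜₊` of `𝒜` generated by `F`, `K⁻¹`, `EK⁻¹`. -/
def APlus (q : ℂˣ) (c₀ : ℂ) : Subalgebra ℂ (A q c₀) := Algebra.adjoin ℂ (plusGens q c₀)

/-- The filtration `𝒜_{≤ i}` of `𝒜₊` in which each of the generators `F`, `K⁻¹`, `EK⁻¹` has
degree `2`: the span of the words of degree at most `i` in these generators. -/
def filt (q : ℂˣ) (c₀ : ℂ) (i : ℕ) : Submodule ℂ (APlus q c₀) :=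
  Submodule.span ℂ {x | ∃ l : List (A q c₀),
    (∀ y ∈ l, y ∈ plusGens q c₀) ∧ 2 * l.length ≤ i ∧ (x : A q c₀) = l.prod}

instance filt_gradedMonoid (q : ℂˣ) (c₀ : ℂ) : SetLike.GradedMonoid (filt q c₀) where
  one_mem := Submodule.subset_span ⟨[], by simp, by simp, by simp⟩
  mul_mem := by
    intro i j x y hx hy
    have h := Submodule.mul_mem_mul hx hy
    rw [filt, filt, Submodule.span_mul_span] at h
    refine Submodule.span_mono ?_ h
    rintro _ ⟨a, ⟨l, hl, hli, hla⟩, b, ⟨m, hm, hmj, hmb⟩, rfl⟩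
    refine ⟨l ++ m, ?_, ?_, ?_⟩
    · intro z hz
      rcases List.mem_append.1 hz with h | h
      exacts [hl z h, hm z h]
    · simp only [List.length_append]; omega
    · simp [hla, hmb]

/-- The restriction to `𝒜₊` of a linear functional on `𝒜`. -/
def restrictPlus (q : ℂˣ) (c₀ : ℂ) (T : A q c₀ →ₗ[ℂ] ℂ) : APlus q c₀ →ₗ[ℂ] ℂ :=
  T ∘ₗ (APlus q c₀).val.toLinearMap

/-- `T` is a `g_{q⁻²}`-twisted trace on `𝒜` that does not vanish identically on `𝒜₊`. -/
def IsInvariantTrace (q : ℂˣ) (c₀ : ℂ) (T : A q c₀ →ₗ[ℂ] ℂ) : Prop :=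
  IsTwistedTrace q c₀ (q ^ 2)⁻¹ T ∧ restrictPlus q c₀ T ≠ 0

end QSl2

/-- The `ℂ`-algebra `B` has a nonzero finite-dimensional representation. -/
def HasFiniteDimensionalRep (B : Type) [Ring B] [Algebra ℂ B] : Prop :=
  ∃ (V : Type) (_ : AddCommGroup V) (_ : Module ℂ V),
    FiniteDimensional ℂ V ∧ Nontrivial V ∧ Nonempty (B →ₐ[ℂ] Module.End ℂ V)

/-- The bilinear form `(a, b) = T(ab)` of a linear functional `T` on an algebra. -/
def traceForm {R : Type*} [Ring R] [Algebra ℂ R] (T : R →ₗ[ℂ] ℂ) : R →ₗ[ℂ] R →ₗ[ℂ] ℂ :=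
  (LinearMap.mul ℂ R).compr₂ T

/-- `T` is nondegenerate with respect to the filtration `F`: for every `i` the form `T(ab)` on
`F i` is nondegenerate (its left and right kernels are zero). -/
def IsNondegenerateOn {R : Type*} [Ring R] [Algebra ℂ R] (F : ℕ → Submodule ℂ R)
    (T : R →ₗ[ℂ] ℂ) : Prop :=
  ∀ i, ((traceForm T).domRestrict₁₂ (F i) (F i)).Nondegenerate

/-! ## Associated graded algebras -/

namespace Filt

variable {R : Type*} [Ring R] [Algebra ℂ R] (F : ℕ → Submodule ℂ R)

/-- `F_{≤ k-1}`, with `F_{≤ -1} = 0`. -/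
def lower : ℕ → Submodule ℂ R
  | 0 => ⊥
  | k + 1 => F k

/-- The homogeneous component `gr_k = F_{≤ k} / F_{≤ k-1}` of the associated graded algebra. -/
abbrev Gr (k : ℕ) : Type _ := F k ⧸ (lower F k).comap (F k).subtype

/-- The class in `gr_k` of an element of `F_{≤ k}`. -/
def cls (k : ℕ) (x : R) (hx : x ∈ F k) : Gr F k := Submodule.Quotient.mk ⟨x, hx⟩

variable {F}

theorem mem_lower {j k : ℕ} (h : j + 1 = k) {x : R} (hx : x ∈ F j) : x ∈ lower F k := by
  subst h; exact hx

theorem exists_cls {k : ℕ} (a : Gr F k) : ∃ x hx, cls F k x hx = a := by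
  obtain ⟨⟨x, hx⟩, rfl⟩ := Submodule.Quotient.mk_surjective _ a
  exact ⟨x, hx, rfl⟩

variable (F)

theorem mk_cls_congr {k m : ℕ} {x y : R} (hx : x ∈ F k) (hy : y ∈ F m) (h : k = m) (e : x = y) :
    (GradedMonoid.mk k (cls F k x hx) : GradedMonoid (Gr F)) =
      GradedMonoid.mk m (cls F m y hy) := by
  subst h; subst e; rfl

variable [SetLike.GradedMonoid F]

/-- The product `gr_k × gr_m → gr_{k+m}`. -/
def grMul (k m : ℕ) : Gr F k →ₗ[ℂ] Gr F m →ₗ[ℂ] Gr F (k + m) :=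
  Submodule.liftQ _
    { toFun := fun x => Submodule.liftQ _
        { toFun := fun y => cls F (k + m) (x.1 * y.1) (SetLike.mul_mem_graded x.2 y.2)
          map_add' := fun y z => by
            rw [cls, cls, cls, ← Submodule.Quotient.mk_add]
            exact congrArg _ (Subtype.ext (mul_add _ _ _))
          map_smul' := fun c y => by
            rw [RingHom.id_apply, cls, cls, ← Submodule.Quotient.mk_smul]
            exact congrArg _ (Subtype.ext (mul_smul_comm _ _ _)) }
        (by
          rintro ⟨y, hy⟩ hy'
          refine (Submodule.Quotient.mk_eq_zero _).2 ?_
          change x.1 * y ∈ lower F (k + m)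
          change y ∈ lower F m at hy'
          cases m with
          | zero =>
            rw [(Submodule.mem_bot ℂ).1 hy', mul_zero]
            exact zero_mem _
          | succ m => exact mem_lower (by omega) (SetLike.mul_mem_graded x.2 hy'))
      map_add' := fun x z => by
        refine LinearMap.ext fun b => ?_
        obtain ⟨y, hy, rfl⟩ := exists_cls b
        change cls F (k + m) ((x.1 + z.1) * y) _ =
          cls F (k + m) (x.1 * y) _ + cls F (k + m) (z.1 * y) _
        rw [cls, cls, cls, ← Submodule.Quotient.mk_add]
        exact congrArg _ (Subtype.ext (add_mul _ _ _))
      map_smul' := fun c x => by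
        refine LinearMap.ext fun b => ?_
        obtain ⟨y, hy, rfl⟩ := exists_cls b
        change cls F (k + m) ((c • x.1) * y) _ = c • cls F (k + m) (x.1 * y) _
        rw [cls, cls, ← Submodule.Quotient.mk_smul]
        exact congrArg _ (Subtype.ext (smul_mul_assoc _ _ _)) }
    (by
      rintro ⟨x, hx⟩ hx'
      change x ∈ lower F k at hx'
      refine (LinearMap.mem_ker).2 (LinearMap.ext fun b => ?_)
      obtain ⟨y, hy, rfl⟩ := exists_cls b
      refine (Submodule.Quotient.mk_eq_zero _).2 ?_
      change x * y ∈ lower F (k + m)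
      cases k with
      | zero =>
        rw [(Submodule.mem_bot ℂ).1 hx', zero_mul]
        exact zero_mem _
      | succ k => exact mem_lower (by omega) (SetLike.mul_mem_graded hx' hy))

theorem grMul_cls {k m : ℕ} {x y : R} (hx : x ∈ F k) (hy : y ∈ F m) :
    grMul F k m (cls F k x hx) (cls F m y hy) =
      cls F (k + m) (x * y) (SetLike.mul_mem_graded hx hy) := rfl

instance : GradedMonoid.GMul (Gr F) where
  mul {k m} a b := grMul F k m a b

instance : GradedMonoid.GOne (Gr F) where
  one := cls F 0 1 SetLike.GradedOne.one_mem

/-- The associated graded algebra `gr R = ⨁ F_{≤ k} / F_{≤ k-1}` is a graded ring. -/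
instance : DirectSum.GRing (Gr F) where
  mul_zero a := map_zero (grMul F _ _ a)
  zero_mul b := LinearMap.map_zero₂ (grMul F _ _) b
  mul_add a b c := map_add (grMul F _ _ a) b c
  add_mul a b c := LinearMap.map_add₂ (grMul F _ _) a b c
  one_mul := by
    rintro ⟨k, a⟩
    obtain ⟨x, hx, rfl⟩ := exists_cls a
    exact mk_cls_congr F (SetLike.mul_mem_graded SetLike.GradedOne.one_mem hx) hx
      (zero_add k) (one_mul x)
  mul_one := by
    rintro ⟨k, a⟩
    obtain ⟨x, hx, rfl⟩ := exists_cls a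
    exact mk_cls_congr F (SetLike.mul_mem_graded hx SetLike.GradedOne.one_mem) hx
      (add_zero k) (mul_one x)
  mul_assoc := by
    rintro ⟨k, a⟩ ⟨l, b⟩ ⟨m, c⟩
    obtain ⟨x, hx, rfl⟩ := exists_cls a
    obtain ⟨y, hy, rfl⟩ := exists_cls b
    obtain ⟨z, hz, rfl⟩ := exists_cls c
    exact mk_cls_congr F
      (SetLike.mul_mem_graded (SetLike.mul_mem_graded hx hy) hz)
      (SetLike.mul_mem_graded hx (SetLike.mul_mem_graded hy hz))
      (add_assoc k l m) (mul_assoc x y z)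
  natCast n := n • cls F 0 1 SetLike.GradedOne.one_mem
  natCast_zero := zero_smul _ _
  natCast_succ n := by
    rw [add_smul, one_smul]; rfl
  intCast n := n • cls F 0 1 SetLike.GradedOne.one_mem
  intCast_ofNat n := by
    rw [natCast_zsmul]
  intCast_negSucc_ofNat n := by
    rw [negSucc_zsmul]

end Filt

/-! ## Short star-products -/

section Star

variable (B : ℕ → Type*) [∀ k, AddCommGroup (B k)] [∀ k, Module ℂ (B k)] [DirectSum.GRing B]

/-- A bilinear product `*` on the graded algebra `B = ⨁ B_k` is a short star-product if it is
associative and for `a ∈ B_k`, `b ∈ B_m` one has `a * b = ∑_{i = 0}^{min(k,m)} c_i(a, b)` with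
`c_i(a, b) ∈ B_{k+m-2i}` and `c_0(a, b) = ab`. -/
structure IsShortStarProduct (s : (⨁ k, B k) →ₗ[ℂ] (⨁ k, B k) →ₗ[ℂ] (⨁ k, B k)) : Prop where
  assoc : ∀ x y z, s (s x y) z = s x (s y z)
  leading : ∀ (k m : ℕ) (a : B k) (b : B m),
    s (DirectSum.of B k a) (DirectSum.of B m b) (k + m) = GradedMonoid.GMul.mul a b
  short : ∀ (k m : ℕ) (a : B k) (b : B m) (n : ℕ),
    s (DirectSum.of B k a) (DirectSum.of B m b) n ≠ 0 → ∃ i, i ≤ min k m ∧ n + 2 * i = k + m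

/-- A short star-product is nondegenerate if for every `k` the form `(a, b) = CT(a * b)` on `B_k`
is nondegenerate, where `CT` is the component of degree zero. -/
def IsNondegenerateStar (s : (⨁ k, B k) →ₗ[ℂ] (⨁ k, B k) →ₗ[ℂ] (⨁ k, B k)) : Prop :=
  ∀ k : ℕ,
    (∀ a : B k, (∀ b : B k, s (DirectSum.of B k a) (DirectSum.of B k b) 0 = 0) → a = 0) ∧
    (∀ b : B k, (∀ a : B k, s (DirectSum.of B k a) (DirectSum.of B k b) 0 = 0) → b = 0)

end Star

section Quantization

variable {R : Type*} [Ring R] [Algebra ℂ R] (F : ℕ → Submodule ℂ R)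

/-- The linear isomorphism `φ : gr R → R` that sends `a ∈ gr_k` to the lift of `a` to `F_{≤ k}`
that is orthogonal (on both sides) to `F_{≤ k-1}` with respect to the form `T(ab)`. -/
def IsOrthogonalLift (T : R →ₗ[ℂ] ℂ) (φ : (⨁ k, Filt.Gr F k) ≃ₗ[ℂ] R) : Prop :=
  ∀ (k : ℕ) (a : Filt.Gr F k),
    (∃ h, Filt.cls F k (φ (DirectSum.of (Filt.Gr F) k a)) h = a) ∧
    ∀ b ∈ Filt.lower F k,
      T (b * φ (DirectSum.of (Filt.Gr F) k a)) = 0 ∧ T (φ (DirectSum.of (Filt.Gr F) k a) * b) = 0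

variable {F}

/-- The product `a * b = φ⁻¹(φ(a)φ(b))` on `gr R` transported along `φ`. -/
def transportedProduct (φ : (⨁ k, Filt.Gr F k) ≃ₗ[ℂ] R) :
    (⨁ k, Filt.Gr F k) →ₗ[ℂ] (⨁ k, Filt.Gr F k) →ₗ[ℂ] (⨁ k, Filt.Gr F k) :=
  ((LinearMap.mul ℂ R).compl₁₂ φ.toLinearMap φ.toLinearMap).compr₂ φ.symm.toLinearMap

variable (F)

/-- `T` gives a nondegenerate short star-product on `gr R`: the orthogonal lift `φ : gr R → R`
exists and is unique, and the transported product is a nondegenerate short star-product. Its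
constant term is given by `T`: one has `T(φ(x)) = T(φ(x₀))`, where `x₀` is the component of `x`
of degree zero. -/
def GivesNondegenerateShortStar [SetLike.GradedMonoid F] (T : R →ₗ[ℂ] ℂ) : Prop :=
  ∃ φ : (⨁ k, Filt.Gr F k) ≃ₗ[ℂ] R,
    IsOrthogonalLift F T φ ∧
    (∀ ψ, IsOrthogonalLift F T ψ → ψ = φ) ∧
    IsShortStarProduct (Filt.Gr F) (transportedProduct φ) ∧
    IsNondegenerateStar (Filt.Gr F) (transportedProduct φ) ∧
    ∀ x, T (φ x) = T (φ (DirectSum.of (Filt.Gr F) 0 (x 0)))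

end Quantization

end

noncomputable section

/-! ## Relations in the central reduction -/

section SkewCommute

variable {R : Type*} [Ring R] [Algebra ℂ R] {a b : R} {c : ℂ}

/-! Put x = K⁻¹, e = EK⁻¹, f = F. In 𝒜 one has ex = q²xe and fx = q⁻²xf, while ef and fe are
quadratic polynomials in x. Hence 𝒜₊ is spanned by the monomials x^b e^n and x^b f^n, those with b +
n ≤ i/2 span 𝒜_{≤i}, and every element of 𝒜 is carried into 𝒜₊ by a power of x.

Uniqueness: a twisted trace T commutes with K, so it lives in weight 0. Moving e around in T(e x^b
f) gives a three-term recurrence for T(x^b), whose leading coefficient involves q^(2b+6) - 1 ≠ 0. So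
T on 𝒜₊ is determined by T(1) (`IsTwistedTrace.x_pow_eq_zero`). Existence: over all powers of K the
recurrence is solved by Chebyshev polynomials (`exists_sequence`), and an explicit module of
functions on ℤ × ℤ turns the solution into a functional on 𝒜 without a basis theorem
(`exists_functional`).

Nondegeneracy: the operator `raise` is, up to scalars on weight vectors, ad(E). It preserves the
filtration and is skew for the form up to scalars, so it preserves radicals. It sends a nonzero
weight vector, after enough steps, to a nonzero multiple of a highest weight vector e^m. So a
nonzero radical on some 𝒜_{≤i} contains some e^m, whence T(e^m f^m) = 0 with m > 0. Skewness then
puts e^m, and f^m too, in the kernel on all of 𝒜₊. That kernel is a two-sided ideal containing f^m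
e^m = Q(x) with Q(0) ≠ 0, so the quotient is finite-dimensional, nonzero, and x is invertible on it.
It is therefore a representation of 𝒜 (`hasFiniteDimensionalRep_of_trace_eq_zero`).

Conversely, for a finite-dimensional ρ the functional tr ρ(aK⁻¹) is a twisted trace, hence a nonzero
multiple of T on 𝒜₊, and the characteristic polynomial of ρ(x) evaluated at x lies in its kernel
(`exists_mem_kernel_of_rep`).

Genericity: comparing the Casimir on the ends of a K-string in a finite-dimensional representation
leaves countably many c₀. Away from them, orthogonalizing the filtration (`IsOrthogonalizable`)
gives φ. The bounds on the degrees of a * b follow from orthogonality, and their parity from the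
vanishing of the odd graded pieces. -/

theorem pow_mul_of_mul_eq_smul (h : a * b = c • (b * a)) (n : ℕ) :
    a ^ n * b = c ^ n • (b * a ^ n) := by
  induction n with
  | zero => simp
  | succ n ih =>
    rw [pow_succ, mul_assoc, h, mul_smul_comm, ← mul_assoc, ih, smul_mul_assoc, smul_smul,
      mul_assoc, pow_succ c, mul_comm c]

theorem mul_pow_of_mul_eq_smul (h : a * b = c • (b * a)) (n : ℕ) :
    a * b ^ n = c ^ n • (b ^ n * a) := by
  induction n with
  | zero => simp
  | succ n ih =>
    rw [pow_succ, ← mul_assoc, ih, smul_mul_assoc, mul_assoc, h, mul_smul_comm, smul_smul,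
      ← mul_assoc, pow_succ c]

theorem mul_aeval_of_mul_eq_smul (h : a * b = c • (b * a)) (R : Polynomial ℂ) :
    a * Polynomial.aeval b R =
      Polynomial.aeval b (R.comp (Polynomial.C c * Polynomial.X)) * a := by
  induction R using Polynomial.induction_on' with
  | add p r hp hr => simp only [map_add, mul_add, add_mul, Polynomial.add_comp, hp, hr]
  | monomial n z =>
    rw [Polynomial.aeval_monomial, Polynomial.monomial_comp, mul_pow, ← Algebra.smul_def,
      mul_smul_comm, mul_pow_of_mul_eq_smul h]
    simp only [map_mul, Polynomial.aeval_C, Polynomial.aeval_X_pow, ← Algebra.smul_def,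
      ← map_pow, smul_mul_assoc]

end SkewCommute

namespace QSl2

variable {q : ℂˣ} {c₀ : ℂ}

/-- The constant `(q - q⁻¹)⁻²`. -/
def casimirScale (q : ℂˣ) : ℂ := (((q : ℂ) - (q : ℂ)⁻¹) ^ 2)⁻¹

/-- `K` in `𝒜`. -/
def A.k : A q c₀ := A.of q c₀ .K

/-- `K⁻¹` in `𝒜`. -/
def A.x : A q c₀ := A.of q c₀ .Kinv

/-- `EK⁻¹` in `𝒜`. -/
def A.e : A q c₀ := A.of q c₀ .E * A.of q c₀ .Kinv

/-- `F` in `𝒜`. -/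
def A.f : A q c₀ := A.of q c₀ .F

open A

theorem A.of_rel {a b : FreeAlgebra ℂ Gen} (h : Rel q a b) :
    A.mk q c₀ (Uq.mk q a) = A.mk q c₀ (Uq.mk q b) := by rw [Uq.mk_rel h]

theorem k_mul_x : k * x = (1 : A q c₀) := by
  have h := A.of_rel (c₀ := c₀) (Rel.K_mul_Kinv (q := q))
  rwa [map_mul, map_mul, map_one, map_one] at h

theorem x_mul_k : x * k = (1 : A q c₀) := by
  have h := A.of_rel (c₀ := c₀) (Rel.Kinv_mul_K (q := q))
  rwa [map_mul, map_mul, map_one, map_one] at h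

theorem of_E : A.of q c₀ .E = e * k := by
  have h := x_mul_k (q := q) (c₀ := c₀)
  rw [x, k] at h
  rw [e, k, mul_assoc, h, mul_one]

theorem K_E : A.of q c₀ .K * A.of q c₀ .E * A.of q c₀ .Kinv = (q : ℂ) ^ 2 • A.of q c₀ .E := by
  have h := A.of_rel (c₀ := c₀) (Rel.K_E (q := q))
  simp only [map_mul, map_smul] at h
  exact h

theorem k_mul_e : k * e = (q : ℂ) ^ 2 • (e * k : A q c₀) := by
  rw [← of_E, ← K_E, k, e, mul_assoc]

theorem k_mul_f : k * f = ((q : ℂ) ^ 2)⁻¹ • (f * k : A q c₀) := by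
  have h := A.of_rel (c₀ := c₀) (Rel.K_F (q := q))
  simp only [map_mul, map_smul] at h
  change k * f * x = ((q : ℂ) ^ 2)⁻¹ • f at h
  rw [← smul_mul_assoc, ← h, mul_assoc _ x k, x_mul_k, mul_one]

theorem q_sq_ne_zero (q : ℂˣ) : (q : ℂ) ^ 2 ≠ 0 := pow_ne_zero _ q.ne_zero

theorem e_mul_k : e * k = ((q : ℂ) ^ 2)⁻¹ • (k * e : A q c₀) := by
  rw [k_mul_e, smul_smul, inv_mul_cancel₀ (q_sq_ne_zero q), one_smul]

theorem f_mul_k : f * k = (q : ℂ) ^ 2 • (k * f : A q c₀) := by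
  rw [k_mul_f, smul_smul, mul_inv_cancel₀ (q_sq_ne_zero q), one_smul]

theorem mul_x_of_k_mul {a : A q c₀} {c : ℂ} (h : k * a = c • (a * k)) : a * x = c • (x * a) := by
  have : x * (k * a) * x = x * (c • (a * k)) * x := by rw [h]
  rw [← mul_assoc, x_mul_k, one_mul, mul_smul_comm, smul_mul_assoc, mul_assoc, mul_assoc a,
    k_mul_x, mul_one] at this
  exact this

theorem e_mul_x : e * x = (q : ℂ) ^ 2 • (x * e : A q c₀) := mul_x_of_k_mul k_mul_e

theorem f_mul_x : f * x = ((q : ℂ) ^ 2)⁻¹ • (x * f : A q c₀) := mul_x_of_k_mul k_mul_f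

theorem x_mul_e : x * e = ((q : ℂ) ^ 2)⁻¹ • (e * x : A q c₀) := by
  rw [e_mul_x, smul_smul, inv_mul_cancel₀ (q_sq_ne_zero q), one_smul]

theorem x_mul_f : x * f = (q : ℂ) ^ 2 • (f * x : A q c₀) := by
  rw [f_mul_x, smul_smul, mul_inv_cancel₀ (q_sq_ne_zero q), one_smul]

theorem F_mul_E : A.of q c₀ .F * A.of q c₀ .E =
    c₀ • 1 - casimirScale q • ((q : ℂ) • k + (q : ℂ)⁻¹ • x) := by
  have h := A.mk_casimir q c₀
  rw [casimir, AlgHom.commutes, map_add, map_mul, map_smul, map_add, map_smul, map_smul,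
    Algebra.algebraMap_eq_smul_one] at h
  exact eq_sub_of_add_eq h

theorem f_mul_e : f * e = c₀ • (x : A q c₀) -
    casimirScale q • ((q : ℂ) • 1 + (q : ℂ)⁻¹ • x ^ 2) := by
  have h := congrArg (· * x) (F_mul_E (q := q) (c₀ := c₀))
  simp only [sub_mul, smul_mul_assoc, one_mul, add_mul, k_mul_x, ← pow_two] at h
  rw [← h, f, e, mul_assoc]; rfl

theorem q_sub_inv_ne_zero (hq : ∀ n : ℕ, 0 < n → q ^ n ≠ 1) : (q : ℂ) - (q : ℂ)⁻¹ ≠ 0 := by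
  intro h
  apply hq 2 (by norm_num)
  ext
  have := q.ne_zero
  field_simp at h
  push_cast
  linear_combination h

theorem casimirScale_ne_zero (hq : ∀ n : ℕ, 0 < n → q ^ n ≠ 1) : casimirScale q ≠ 0 :=
  inv_ne_zero (pow_ne_zero _ (q_sub_inv_ne_zero hq))

theorem pow_ne_one (hq : ∀ n : ℕ, 0 < n → q ^ n ≠ 1) {n : ℕ} (hn : 0 < n) : (q : ℂ) ^ n ≠ 1 := by
  intro h
  exact hq n hn (by ext; push_cast; exact h)

/-- The Casimir can equally be written with EF in place of FE, at the price of exchanging q and q⁻¹.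
This requires q² ≠ 1, because in Lean (q - q⁻¹)⁻¹ would otherwise be 0. -/
theorem E_mul_F (hq : ∀ n : ℕ, 0 < n → q ^ n ≠ 1) : A.of q c₀ .E * A.of q c₀ .F =
    c₀ • 1 - casimirScale q • ((q : ℂ)⁻¹ • k + (q : ℂ) • x) := by
  have h := A.of_rel (c₀ := c₀) (Rel.E_F (q := q))
  simp only [map_mul, map_smul, map_sub] at h
  change A.of q c₀ .E * A.of q c₀ .F - A.of q c₀ .F * A.of q c₀ .E = _ • (k - x) at h
  have h2 : ((q : ℂ) - (q : ℂ)⁻¹)⁻¹ = casimirScale q * ((q : ℂ) - (q : ℂ)⁻¹) := by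
    have := q_sub_inv_ne_zero hq
    rw [casimirScale]
    field_simp
  rw [h2] at h
  rw [eq_add_of_sub_eq h, F_mul_E]
  module

theorem e_mul_f (hq : ∀ n : ℕ, 0 < n → q ^ n ≠ 1) : e * f = ((q : ℂ) ^ 2 * c₀) • (x : A q c₀) -
    casimirScale q • ((q : ℂ) • 1 + (q : ℂ) ^ 3 • x ^ 2) := by
  have h := congrArg (fun y => (q : ℂ) ^ 2 • (y * x)) (E_mul_F (c₀ := c₀) hq)
  simp only [sub_mul, smul_mul_assoc, one_mul, add_mul, k_mul_x, ← pow_two] at h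
  have h2 : e * f = (q : ℂ) ^ 2 • (A.of q c₀ .E * A.of q c₀ .F * x) := by
    rw [mul_assoc, show A.of q c₀ .F * x = f * x from rfl, f_mul_x, mul_smul_comm, smul_smul,
      mul_inv_cancel₀ (q_sq_ne_zero q), one_smul, ← mul_assoc]
    rfl
  rw [h2, h]
  have := q.ne_zero
  match_scalars <;> field_simp

/-! ## Generation by `F`, `K^{±1}`, `EK⁻¹` -/

theorem A.induction {p : A q c₀ → Prop} (one : p 1) (add : ∀ a b, p a → p b → p (a + b))
    (smul : ∀ (c : ℂ) a, p a → p (c • a)) (hk : ∀ a, p a → p (k * a)) (hx : ∀ a, p a → p (x * a))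
    (he : ∀ a, p a → p (e * a)) (hf : ∀ a, p a → p (f * a)) (a : A q c₀) : p a := by
  obtain ⟨b, rfl⟩ := RingQuot.mkAlgHom_surjective ℂ (CentralRel q c₀) a
  obtain ⟨b, rfl⟩ := RingQuot.mkAlgHom_surjective ℂ (Rel q) b
  let m : FreeAlgebra ℂ Gen →ₐ[ℂ] A q c₀ := (A.mk q c₀).comp (Uq.mk q)
  change p (m b)
  -- Only left multiplication by generators is available, so the induction on words carries an
  -- arbitrary right factor y.
  suffices h : ∀ y, p y → p (m b * y) by simpa using h 1 one
  induction b using FreeAlgebra.induction with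
  | grade0 r =>
    intro y hy
    rw [AlgHom.commutes, ← Algebra.smul_def]
    exact smul _ _ hy
  | grade1 g =>
    intro y hy
    change p (A.of q c₀ g * y)
    cases g
    · rw [of_E, mul_assoc]
      exact he _ (hk _ hy)
    · exact hf _ hy
    · exact hk _ hy
    · exact hx _ hy
  | mul a b ha hb =>
    intro y hy
    rw [map_mul, mul_assoc]
    exact ha _ (hb _ hy)
  | add a b ha hb =>
    intro y hy
    rw [map_add, add_mul]
    exact add _ _ (ha _ hy) (hb _ hy)

/-- The span of `x^b e^n` and `x^b f^n` with `b + n ≤ d`. -/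
def monoSpan (q : ℂˣ) (c₀ : ℂ) (d : ℕ) : Submodule ℂ (A q c₀) :=
  Submodule.span ℂ {y | ∃ b n, b + n ≤ d ∧ (y = x ^ b * e ^ n ∨ y = x ^ b * f ^ n)}

theorem xe_mem {d b n : ℕ} (h : b + n ≤ d) : x ^ b * e ^ n ∈ monoSpan q c₀ d :=
  Submodule.subset_span ⟨b, n, h, Or.inl rfl⟩

theorem xf_mem {d b n : ℕ} (h : b + n ≤ d) : x ^ b * f ^ n ∈ monoSpan q c₀ d :=
  Submodule.subset_span ⟨b, n, h, Or.inr rfl⟩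

theorem monoSpan_mono : Monotone (monoSpan q c₀) := fun _ _ h =>
  Submodule.span_mono fun _ ⟨b, n, hb, hy⟩ => ⟨b, n, hb.trans h, hy⟩

theorem monoSpan_induction {d : ℕ} {p : A q c₀ → Prop} (zero : p 0)
    (add : ∀ a b, p a → p b → p (a + b))
    (smul : ∀ (c : ℂ) a, p a → p (c • a)) (he : ∀ b n, b + n ≤ d → p (x ^ b * e ^ n))
    (hf : ∀ b n, b + n ≤ d → p (x ^ b * f ^ n)) {a : A q c₀} (ha : a ∈ monoSpan q c₀ d) : p a := by
  refine Submodule.span_induction (p := fun a _ => p a) ?_ zero (fun a b _ _ => add a b)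
    (fun c a _ => smul c a) ha
  rintro _ ⟨b, n, h, rfl | rfl⟩
  exacts [he b n h, hf b n h]

theorem map_mem_monoSpan {d d' : ℕ} (L : A q c₀ →ₗ[ℂ] A q c₀)
    (he : ∀ b n, b + n ≤ d → L (x ^ b * e ^ n) ∈ monoSpan q c₀ d')
    (hf : ∀ b n, b + n ≤ d → L (x ^ b * f ^ n) ∈ monoSpan q c₀ d') {a : A q c₀}
    (ha : a ∈ monoSpan q c₀ d) : L a ∈ monoSpan q c₀ d' :=
  monoSpan_induction (p := fun a => L a ∈ monoSpan q c₀ d') (by simp)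
    (fun a b ha hb => by rw [map_add]; exact add_mem ha hb)
    (fun c a ha => by rw [map_smul]; exact Submodule.smul_mem _ _ ha) he hf ha

theorem x_mul_mem {d : ℕ} {a : A q c₀} (ha : a ∈ monoSpan q c₀ d) :
    x * a ∈ monoSpan q c₀ (d + 1) := by
  refine map_mem_monoSpan (LinearMap.mulLeft ℂ x) (fun b n h => ?_) (fun b n h => ?_) ha
  · rw [LinearMap.mulLeft_apply, ← mul_assoc, ← pow_succ']
    exact xe_mem (by omega)
  · rw [LinearMap.mulLeft_apply, ← mul_assoc, ← pow_succ']
    exact xf_mem (by omega)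

theorem e_mul_x_pow (b : ℕ) : e * x ^ b = ((q : ℂ) ^ 2) ^ b • (x ^ b * e : A q c₀) :=
  mul_pow_of_mul_eq_smul e_mul_x b

theorem f_mul_x_pow (b : ℕ) : f * x ^ b = (((q : ℂ) ^ 2)⁻¹) ^ b • (x ^ b * f : A q c₀) :=
  mul_pow_of_mul_eq_smul f_mul_x b

theorem e_pow_mul_x (n : ℕ) : e ^ n * x = ((q : ℂ) ^ 2) ^ n • (x * e ^ n : A q c₀) :=
  pow_mul_of_mul_eq_smul e_mul_x n

theorem f_pow_mul_x (n : ℕ) : f ^ n * x = (((q : ℂ) ^ 2)⁻¹) ^ n • (x * f ^ n : A q c₀) :=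
  pow_mul_of_mul_eq_smul f_mul_x n

theorem e_mul_xe (b n : ℕ) :
    e * (x ^ b * e ^ n) = ((q : ℂ) ^ 2) ^ b • (x ^ b * e ^ (n + 1) : A q c₀) := by
  rw [← mul_assoc, e_mul_x_pow, smul_mul_assoc, mul_assoc, ← pow_succ']

theorem f_mul_xf (b n : ℕ) :
    f * (x ^ b * f ^ n) = (((q : ℂ) ^ 2)⁻¹) ^ b • (x ^ b * f ^ (n + 1) : A q c₀) := by
  rw [← mul_assoc, f_mul_x_pow, smul_mul_assoc, mul_assoc, ← pow_succ']

theorem e_mul_xf (hq : ∀ n : ℕ, 0 < n → q ^ n ≠ 1) (b n : ℕ) :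
    e * (x ^ b * f ^ (n + 1)) = ((q : ℂ) ^ 2) ^ b • (((q : ℂ) ^ 2 * c₀) • (x ^ (b + 1) * f ^ n) -
      casimirScale q • ((q : ℂ) • (x ^ b * f ^ n) + (q : ℂ) ^ 3 • (x ^ (b + 2) * f ^ n : A q c₀))) := by
  rw [← mul_assoc, e_mul_x_pow, smul_mul_assoc, mul_assoc, pow_succ' f, ← mul_assoc e, e_mul_f hq]
  simp only [sub_mul, add_mul, mul_sub, mul_add, smul_mul_assoc, mul_smul_comm, one_mul,
    ← mul_assoc, ← pow_succ, ← pow_add]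

theorem f_mul_xe (b n : ℕ) :
    f * (x ^ b * e ^ (n + 1)) = (((q : ℂ) ^ 2)⁻¹) ^ b • (c₀ • (x ^ (b + 1) * e ^ n) -
      casimirScale q • ((q : ℂ) • (x ^ b * e ^ n) + (q : ℂ)⁻¹ • (x ^ (b + 2) * e ^ n : A q c₀))) := by
  rw [← mul_assoc, f_mul_x_pow, smul_mul_assoc, mul_assoc, pow_succ' e, ← mul_assoc f, f_mul_e]
  simp only [sub_mul, add_mul, mul_sub, mul_add, smul_mul_assoc, mul_smul_comm, one_mul,
    ← mul_assoc, ← pow_succ, ← pow_add]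

theorem e_mul_mem (hq : ∀ n : ℕ, 0 < n → q ^ n ≠ 1) {d : ℕ} {a : A q c₀}
    (ha : a ∈ monoSpan q c₀ d) : e * a ∈ monoSpan q c₀ (d + 1) := by
  refine map_mem_monoSpan (LinearMap.mulLeft ℂ e) (fun b n h => ?_) (fun b n h => ?_) ha
  · rw [LinearMap.mulLeft_apply, e_mul_xe]
    exact Submodule.smul_mem _ _ (xe_mem (by omega))
  · rw [LinearMap.mulLeft_apply]
    cases n with
    | zero =>
      have := e_mul_xe (q := q) (c₀ := c₀) b 0
      rw [pow_zero] at this ⊢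
      rw [this]
      exact Submodule.smul_mem _ _ (xe_mem (by omega))
    | succ n =>
      rw [e_mul_xf hq]
      refine Submodule.smul_mem _ _ (sub_mem ?_ (Submodule.smul_mem _ _ (add_mem ?_ ?_))) <;>
      exact Submodule.smul_mem _ _ (xf_mem (by omega))

theorem f_mul_mem {d : ℕ} {a : A q c₀}
    (ha : a ∈ monoSpan q c₀ d) : f * a ∈ monoSpan q c₀ (d + 1) := by
  refine map_mem_monoSpan (LinearMap.mulLeft ℂ f) (fun b n h => ?_) (fun b n h => ?_) ha
  · rw [LinearMap.mulLeft_apply]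
    cases n with
    | zero =>
      have := f_mul_xf (q := q) (c₀ := c₀) b 0
      rw [pow_zero] at this ⊢
      rw [this]
      exact Submodule.smul_mem _ _ (xf_mem (by omega))
    | succ n =>
      rw [f_mul_xe]
      refine Submodule.smul_mem _ _ (sub_mem ?_ (Submodule.smul_mem _ _ (add_mem ?_ ?_))) <;>
      exact Submodule.smul_mem _ _ (xe_mem (by omega))
  · rw [LinearMap.mulLeft_apply, f_mul_xf]
    exact Submodule.smul_mem _ _ (xf_mem (by omega))

theorem one_mem_monoSpan (d : ℕ) : (1 : A q c₀) ∈ monoSpan q c₀ d := by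
  simpa using xe_mem (q := q) (c₀ := c₀) (d := d) (b := 0) (n := 0) (by omega)

theorem k_pow_mul_x_pow (n : ℕ) : k ^ n * x ^ n = (1 : A q c₀) := by
  induction n with
  | zero => simp
  | succ n ih =>
    rw [pow_succ, pow_succ', mul_assoc, ← mul_assoc k, k_mul_x, one_mul, ih]

/-- Every element of 𝒜 is a left fraction x^(-i) a with a ∈ 𝒜₊, because x commutes with the
generators up to nonzero scalars. This is what extends arguments on monomials of 𝒜₊ to all of 𝒜. -/
theorem exists_x_pow_mul_mem (hq : ∀ n : ℕ, 0 < n → q ^ n ≠ 1) (a : A q c₀) :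
    ∃ i d, x ^ i * a ∈ monoSpan q c₀ d := by
  have hx : ∀ {d i : ℕ} {a : A q c₀}, a ∈ monoSpan q c₀ d → x ^ i * a ∈ monoSpan q c₀ (d + i) := by
    intro d i a ha
    induction i with
    | zero => simpa using ha
    | succ i ih => rw [pow_succ', mul_assoc]; exact x_mul_mem ih
  induction a using A.induction with
  | one => exact ⟨0, 0, by simpa using one_mem_monoSpan 0⟩
  | add a b ha hb =>
    obtain ⟨i, d, ha⟩ := ha
    obtain ⟨j, d', hb⟩ := hb
    refine ⟨i + j, (d + j) + (d' + i), ?_⟩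
    rw [mul_add]
    refine add_mem (monoSpan_mono (by omega) (?_ : _ ∈ monoSpan q c₀ (d + j)))
      (monoSpan_mono (by omega) (?_ : _ ∈ monoSpan q c₀ (d' + i)))
    · rw [add_comm i, pow_add, mul_assoc]; exact hx ha
    · rw [pow_add, mul_assoc]; exact hx hb
  | smul c a ha =>
    obtain ⟨i, d, ha⟩ := ha
    exact ⟨i, d, by rw [mul_smul_comm]; exact Submodule.smul_mem _ _ ha⟩
  | hk a ha =>
    obtain ⟨i, d, ha⟩ := ha
    exact ⟨i + 1, d, by rwa [pow_succ, mul_assoc, ← mul_assoc x k, x_mul_k, one_mul]⟩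
  | hx a ha =>
    obtain ⟨i, d, ha⟩ := ha
    refine ⟨i, d + 1, ?_⟩
    rw [← mul_assoc, ← pow_succ, pow_succ', mul_assoc]
    exact x_mul_mem ha
  | he a ha =>
    obtain ⟨i, d, ha⟩ := ha
    refine ⟨i, d + 1, ?_⟩
    rw [← mul_assoc, pow_mul_of_mul_eq_smul x_mul_e, smul_mul_assoc, mul_assoc]
    exact Submodule.smul_mem _ _ (e_mul_mem hq ha)
  | hf a ha =>
    obtain ⟨i, d, ha⟩ := ha
    refine ⟨i, d + 1, ?_⟩
    rw [← mul_assoc, pow_mul_of_mul_eq_smul x_mul_f, smul_mul_assoc, mul_assoc]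
    exact Submodule.smul_mem _ _ (f_mul_mem ha)

/-! ## The filtration of `𝒜₊` in terms of monomials -/

theorem word_mem_monoSpan (hq : ∀ n : ℕ, 0 < n → q ^ n ≠ 1) {l : List (A q c₀)}
    (hl : ∀ y ∈ l, y ∈ plusGens q c₀) : l.prod ∈ monoSpan q c₀ l.length := by
  induction l with
  | nil => simpa using one_mem_monoSpan 0
  | cons a l ih =>
    rw [List.prod_cons, List.length_cons]
    have h := ih fun y hy => hl y (List.mem_cons_of_mem _ hy)
    rcases hl a List.mem_cons_self with rfl | rfl | rfl
    exacts [f_mul_mem h, x_mul_mem h, e_mul_mem hq h]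

theorem f_mem_plusGens : f ∈ plusGens q c₀ := Or.inl rfl
theorem x_mem_plusGens : x ∈ plusGens q c₀ := Or.inr (Or.inl rfl)
theorem e_mem_plusGens : e ∈ plusGens q c₀ := Or.inr (Or.inr rfl)

theorem f_mem : f ∈ APlus q c₀ := Algebra.subset_adjoin f_mem_plusGens
theorem x_mem : x ∈ APlus q c₀ := Algebra.subset_adjoin x_mem_plusGens
theorem e_mem : e ∈ APlus q c₀ := Algebra.subset_adjoin e_mem_plusGens

theorem word_mem_map_filt {l : List (A q c₀)} {i : ℕ} (hl : ∀ y ∈ l, y ∈ plusGens q c₀)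
    (hi : 2 * l.length ≤ i) : l.prod ∈ (filt q c₀ i).map (APlus q c₀).val.toLinearMap :=
  ⟨⟨l.prod, list_prod_mem fun y hy => Algebra.subset_adjoin (hl y hy)⟩,
    Submodule.subset_span ⟨l, hl, hi, rfl⟩, rfl⟩

theorem monomial_mem_map_filt {y : A q c₀} (hy : y ∈ plusGens q c₀) {b n i : ℕ}
    (h : b + n ≤ i / 2) : x ^ b * y ^ n ∈ (filt q c₀ i).map (APlus q c₀).val.toLinearMap := by
  have := word_mem_map_filt (l := List.replicate b x ++ List.replicate n y) (i := i)
    (fun z hz => by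
      rcases List.mem_append.1 hz with hz | hz
      · rw [List.eq_of_mem_replicate hz]; exact x_mem_plusGens
      · rw [List.eq_of_mem_replicate hz]; exact hy)
    (by simp only [List.length_append, List.length_replicate]; omega)
  simpa using this

/-- The relations for ef and fe replace a word of length 2 by monomials of length at most 2, so
reordering never raises the length. The quotient i / 2 appears because each generator has degree 2.
-/
theorem map_filt (hq : ∀ n : ℕ, 0 < n → q ^ n ≠ 1) (i : ℕ) :
    (filt q c₀ i).map (APlus q c₀).val.toLinearMap = monoSpan q c₀ (i / 2) := by
  apply le_antisymm
  · rw [filt, Submodule.map_span, Submodule.span_le]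
    rintro _ ⟨y, ⟨l, hl, hi, hy⟩, rfl⟩
    change (y : A q c₀) ∈ _
    rw [hy]
    exact monoSpan_mono (by omega) (word_mem_monoSpan hq hl)
  · rw [monoSpan, Submodule.span_le]
    rintro _ ⟨b, n, h, rfl | rfl⟩
    exacts [monomial_mem_map_filt e_mem_plusGens h, monomial_mem_map_filt f_mem_plusGens h]

theorem mem_filt_iff (hq : ∀ n : ℕ, 0 < n → q ^ n ≠ 1) {i : ℕ} {y : APlus q c₀} :
    y ∈ filt q c₀ i ↔ (y : A q c₀) ∈ monoSpan q c₀ (i / 2) := by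
  rw [← map_filt hq]
  refine ⟨fun h => ⟨y, h, rfl⟩, ?_⟩
  rintro ⟨z, hz, h⟩
  rwa [← Subtype.ext h]

theorem mem_APlus_of_mem_monoSpan {d : ℕ} {a : A q c₀} (ha : a ∈ monoSpan q c₀ d) :
    a ∈ APlus q c₀ :=
  monoSpan_induction (p := fun a => a ∈ APlus q c₀) (zero_mem _) (fun _ _ => add_mem)
    (fun c _ h => Subalgebra.smul_mem _ h c)
    (fun b n _ => mul_mem (pow_mem x_mem b) (pow_mem e_mem n))
    (fun b n _ => mul_mem (pow_mem x_mem b) (pow_mem f_mem n)) ha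

theorem exists_mem_monoSpan (hq : ∀ n : ℕ, 0 < n → q ^ n ≠ 1) {a : A q c₀}
    (ha : a ∈ APlus q c₀) : ∃ d, a ∈ monoSpan q c₀ d := by
  rw [APlus, ← Subalgebra.mem_toSubmodule, Algebra.adjoin_eq_span] at ha
  induction ha using Submodule.span_induction with
  | mem a ha =>
    obtain ⟨l, hl, rfl⟩ := Submonoid.exists_list_of_mem_closure ha
    exact ⟨_, word_mem_monoSpan hq hl⟩
  | zero => exact ⟨0, zero_mem _⟩
  | add a b _ _ ha hb =>
    obtain ⟨d, ha⟩ := ha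
    obtain ⟨d', hb⟩ := hb
    exact ⟨max d d', add_mem (monoSpan_mono (le_max_left _ _) ha)
      (monoSpan_mono (le_max_right _ _) hb)⟩
  | smul c a _ ha =>
    obtain ⟨d, ha⟩ := ha
    exact ⟨d, Submodule.smul_mem _ _ ha⟩

instance (d : ℕ) : FiniteDimensional ℂ (monoSpan q c₀ d) := by
  refine FiniteDimensional.span_of_finite ℂ ?_
  refine Set.Finite.subset (((Set.finite_Iic d).prod (Set.finite_Iic d)).image
    (fun p : ℕ × ℕ => (x ^ p.1 * e ^ p.2 : A q c₀)) |>.union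
    (((Set.finite_Iic d).prod (Set.finite_Iic d)).image
    (fun p : ℕ × ℕ => (x ^ p.1 * f ^ p.2 : A q c₀)))) ?_
  rintro _ ⟨b, n, h, rfl | rfl⟩
  · exact Or.inl ⟨(b, n), ⟨by simp; omega, by simp; omega⟩, rfl⟩
  · exact Or.inr ⟨(b, n), ⟨by simp; omega, by simp; omega⟩, rfl⟩

theorem finiteDimensional_filt (hq : ∀ n : ℕ, 0 < n → q ^ n ≠ 1) (i : ℕ) :
    FiniteDimensional ℂ (filt q c₀ i) := by
  have : FiniteDimensional ℂ ((filt q c₀ i).map (APlus q c₀).val.toLinearMap) := by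
    rw [map_filt hq]; infer_instance
  exact Module.Finite.equiv
    (Submodule.equivMapOfInjective (APlus q c₀).val.toLinearMap Subtype.val_injective
      (filt q c₀ i)).symm

/-! ## Weights -/

/-- `a` has weight `w` if `K a K⁻¹ = q^{2w} a`. -/
def HasWeight (w : ℤ) (a : A q c₀) : Prop := k * a = ((q : ℂ) ^ 2) ^ w • (a * k)

theorem HasWeight.mul {v w : ℤ} {a b : A q c₀} (ha : HasWeight v a) (hb : HasWeight w b) :
    HasWeight (v + w) (a * b) := by
  rw [HasWeight] at *
  rw [← mul_assoc, ha, smul_mul_assoc, mul_assoc, hb, mul_smul_comm, smul_smul, ← mul_assoc,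
    zpow_add₀ (q_sq_ne_zero q)]

theorem hasWeight_one : HasWeight 0 (1 : A q c₀) := by simp [HasWeight]

theorem HasWeight.pow {w : ℤ} {a : A q c₀} (ha : HasWeight w a) (n : ℕ) :
    HasWeight (n * w) (a ^ n) := by
  induction n with
  | zero => simpa using hasWeight_one
  | succ n ih =>
    rw [pow_succ]
    convert ih.mul ha using 1
    push_cast; ring

theorem hasWeight_e : HasWeight 1 (e : A q c₀) := by
  rw [HasWeight, zpow_one]; exact k_mul_e

theorem hasWeight_f : HasWeight (-1) (f : A q c₀) := by
  rw [HasWeight, zpow_neg_one]; exact k_mul_f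

theorem hasWeight_x : HasWeight 0 (x : A q c₀) := by
  simp [HasWeight, k_mul_x, x_mul_k]

theorem hasWeight_xe (b n : ℕ) : HasWeight n (x ^ b * e ^ n : A q c₀) := by
  simpa using (hasWeight_x.pow b).mul (hasWeight_e.pow n)

theorem hasWeight_xf (b n : ℕ) : HasWeight (-n) (x ^ b * f ^ n : A q c₀) := by
  simpa using (hasWeight_x.pow b).mul (hasWeight_f.pow n)

theorem zpow_ne_one (hq : ∀ n : ℕ, 0 < n → q ^ n ≠ 1) {n : ℤ} (hn : n ≠ 0) :
    (q : ℂ) ^ n ≠ 1 := by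
  have key : ∀ m : ℕ, 0 < m → (q : ℂ) ^ (m : ℤ) ≠ 1 := fun m hm => by
    rw [zpow_natCast]; exact pow_ne_one hq hm
  rcases lt_or_gt_of_ne hn with h | h
  · intro h1
    have := key n.natAbs (by omega)
    rw [Int.ofNat_natAbs_of_nonpos h.le, zpow_neg, h1] at this
    simp at this
  · have := key n.natAbs (by omega)
    rwa [Int.natAbs_of_nonneg h.le] at this

theorem sq_zpow_ne_one (hq : ∀ n : ℕ, 0 < n → q ^ n ≠ 1) {n : ℤ} (hn : n ≠ 0) :
    ((q : ℂ) ^ 2) ^ n ≠ 1 := by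
  have := zpow_ne_one hq (n := 2 * n) (by omega)
  rwa [zpow_mul] at this

/-! ## Twisted traces -/

namespace IsTwistedTrace

variable {T : A q c₀ →ₗ[ℂ] ℂ} (hT : IsTwistedTrace q c₀ (q ^ 2)⁻¹ T)
include hT

theorem k_mul (a : A q c₀) : T (k * a) = T (a * k) := by
  rw [hT, k, g_of]; simp [gWeight]

theorem x_mul (a : A q c₀) : T (x * a) = T (a * x) := by
  rw [hT, x, g_of]; simp [gWeight]

theorem e_mul (a : A q c₀) : T (e * a) = ((q : ℂ) ^ 2)⁻¹ * T (a * e) := by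
  rw [hT, e, map_mul (g q c₀ _), g_of, g_of]; simp [gWeight]

theorem f_mul (a : A q c₀) : T (f * a) = (q : ℂ) ^ 2 * T (a * f) := by
  rw [hT, f, g_of]; simp [gWeight]

/-- T is invariant under conjugation by K, which multiplies a by q^(2w) ≠ 1. -/
theorem eq_zero_of_hasWeight (hq : ∀ n : ℕ, 0 < n → q ^ n ≠ 1) {w : ℤ} (hw : w ≠ 0) {a : A q c₀}
    (ha : HasWeight w a) : T a = 0 := by
  have h1 : T (k * a * x) = T a := by
    rw [mul_assoc, hT.k_mul, mul_assoc, x_mul_k, mul_one]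
  rw [HasWeight] at ha
  rw [ha, smul_mul_assoc, mul_assoc, k_mul_x, mul_one, map_smul, smul_eq_mul] at h1
  have h2 := sq_zpow_ne_one hq hw
  have h3 : (((q : ℂ) ^ 2) ^ w - 1) * T a = 0 := by linear_combination h1
  exact (mul_eq_zero.1 h3).resolve_left (sub_ne_zero.2 h2)

end IsTwistedTrace

/-! ### Uniqueness of the trace on 𝒜₊, and adjoint invariance -/

namespace IsTwistedTrace

variable {T : A q c₀ →ₗ[ℂ] ℂ} (hT : IsTwistedTrace q c₀ (q ^ 2)⁻¹ T)
include hT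

theorem x_pow_eq_zero (hq : ∀ n : ℕ, 0 < n → q ^ n ≠ 1) (h : T 1 = 0) (b : ℕ) :
    T (x ^ b) = 0 := by
  have hα := casimirScale_ne_zero hq
  have hq0 := q.ne_zero
  induction b using Nat.twoStepInduction with
  | zero => simpa using h
  | one =>
    -- The factor k produces the one instance of the recurrence in which the value T(K), outside 𝒜₊,
    -- cancels. What remains ties T(x) to T(1).
    have h1 := hT.e_mul (k * f)
    rw [← mul_assoc, e_mul_k, smul_mul_assoc, mul_assoc, e_mul_f hq, mul_assoc k f e,
      f_mul_e] at h1
    simp only [mul_sub, mul_add, mul_smul_comm, pow_two x, ← mul_assoc k, k_mul_x, one_mul,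
      mul_one, map_sub, map_add, map_smul, smul_eq_mul, h] at h1
    rw [pow_one]
    have h2 := pow_ne_one hq (n := 4) (by norm_num)
    have h3 : casimirScale q * ((q : ℂ) ^ 4 - 1) * T x = 0 := by
      field_simp at h1
      linear_combination -h1
    exact (mul_eq_zero.1 h3).resolve_left (mul_ne_zero hα (sub_ne_zero.2 h2))
  | more b h1 h2 =>
    have h3 := hT.e_mul (x ^ b * f)
    have h4 := e_mul_xf (c₀ := c₀) hq b 0
    simp only [zero_add, pow_one, pow_zero, mul_one] at h4
    rw [h4, mul_assoc, f_mul_e] at h3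
    simp only [mul_sub, mul_add, mul_smul_comm, ← pow_succ, mul_one, ← pow_add,
      map_sub, map_add, map_smul, smul_eq_mul, h1, h2] at h3
    have h5 := pow_ne_one hq (n := 2 * b + 6) (by omega)
    have h6 : casimirScale q * ((q : ℂ) ^ (2 * b + 6) - 1) * T (x ^ (b + 2)) = 0 := by
      field_simp at h3
      linear_combination -h3
    exact (mul_eq_zero.1 h6).resolve_left (mul_ne_zero hα (sub_ne_zero.2 h5))

theorem restrictPlus_eq_zero (hq : ∀ n : ℕ, 0 < n → q ^ n ≠ 1) (h : T 1 = 0) :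
    restrictPlus q c₀ T = 0 := by
  ext ⟨a, ha⟩
  obtain ⟨d, ha⟩ := exists_mem_monoSpan hq ha
  change T a = 0
  refine monoSpan_induction (p := fun a => T a = 0) (map_zero T)
    (fun a b ha hb => by rw [map_add, ha, hb, add_zero])
    (fun c a ha => by rw [map_smul, ha, smul_zero]) (fun b n _ => ?_) (fun b n _ => ?_) ha
  · rcases eq_or_ne n 0 with rfl | hn
    · simpa using hT.x_pow_eq_zero hq h b
    · exact hT.eq_zero_of_hasWeight hq (by exact_mod_cast hn) (hasWeight_xe b n)
  · rcases eq_or_ne n 0 with rfl | hn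
    · simpa using hT.x_pow_eq_zero hq h b
    · exact hT.eq_zero_of_hasWeight hq (by simpa using hn) (hasWeight_xf b n)

theorem isAdInvariant : IsAdInvariant q c₀ T := by
  have hq0 := q_sq_ne_zero q
  have hk : A.of q c₀ .K = k := rfl
  have hx : A.of q c₀ .Kinv = x := rfl
  have hf : A.of q c₀ .F = f := rfl
  intro a
  rw [of_E, hk, hx, hf]
  refine ⟨?_, ?_, ?_⟩
  · rw [mul_assoc, hT.k_mul, mul_assoc, x_mul_k, mul_one]
  · have h1 : T (e * k * a) = ((q : ℂ) ^ 2)⁻¹ * T (a * (e * k)) := by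
      rw [mul_assoc, hT.e_mul, mul_assoc, hT.k_mul, mul_assoc]
    have h2 : T (k * a * x * (e * k)) = ((q : ℂ) ^ 2)⁻¹ * T (a * (e * k)) := by
      have : x * (e * k) * k = ((q : ℂ) ^ 2)⁻¹ • (e * k : A q c₀) := by
        rw [← mul_assoc x, x_mul_e, smul_mul_assoc, smul_mul_assoc, mul_assoc e, x_mul_k, mul_one]
      rw [mul_assoc, mul_assoc, hT.k_mul, mul_assoc, this, mul_smul_comm, map_smul, smul_eq_mul]
    rw [map_sub, h1, h2, sub_self]
  · rw [sub_mul, map_sub, mul_assoc, hT.f_mul, mul_assoc, mul_assoc, f_mul_k, mul_smul_comm,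
      map_smul, smul_eq_mul, sub_self]

end IsTwistedTrace

theorem IsInvariantTrace.one_ne_zero (hq : ∀ n : ℕ, 0 < n → q ^ n ≠ 1) {T : A q c₀ →ₗ[ℂ] ℂ}
    (hT : IsInvariantTrace q c₀ T) : T 1 ≠ 0 :=
  fun h => hT.2 (hT.1.restrictPlus_eq_zero hq h)

/-- The difference T' - (T'(1)/T(1)) T is a twisted trace vanishing at 1, hence zero on 𝒜₊. -/
theorem IsInvariantTrace.exists_smul (hq : ∀ n : ℕ, 0 < n → q ^ n ≠ 1) {T : A q c₀ →ₗ[ℂ] ℂ}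
    (hT : IsInvariantTrace q c₀ T) {T' : A q c₀ →ₗ[ℂ] ℂ}
    (hT' : IsTwistedTrace q c₀ (q ^ 2)⁻¹ T') :
    ∃ z : ℂ, restrictPlus q c₀ T' = z • restrictPlus q c₀ T := by
  refine ⟨T' 1 / T 1, ?_⟩
  have h : IsTwistedTrace q c₀ (q ^ 2)⁻¹ (T' - (T' 1 / T 1) • T) := by
    intro a b
    simp only [LinearMap.sub_apply, LinearMap.smul_apply, hT.1 a b, hT' a b]
  have h2 := h.restrictPlus_eq_zero hq (by simp [hT.one_ne_zero hq])
  exact sub_eq_zero.1 h2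

/-! ## The lowering and raising operator -/

open Polynomial in
theorem aeval_mul_k {S : ℂ[X]} (hS : S.coeff 0 = 0) :
    aeval (x : A q c₀) S * k = aeval x S.divX := by
  conv_lhs => rw [← divX_mul_X_add S, hS]
  simp [mul_assoc, x_mul_k]

theorem aeval_quadratic (a b c d : ℂ) :
    Polynomial.aeval (x : A q c₀) (Polynomial.C a * Polynomial.X - Polynomial.C b *
      (Polynomial.C c + Polynomial.C d * Polynomial.X ^ 2)) =
      a • x - b • (c • 1 + d • x ^ 2) := by
  simp [Algebra.algebraMap_eq_smul_one]

theorem coeff_two_quadratic (a b c d : ℂ) :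
    (Polynomial.C a * Polynomial.X - Polynomial.C b *
      (Polynomial.C c + Polynomial.C d * Polynomial.X ^ 2)).coeff 2 = -(b * d) := by
  simp

/-- The operator `y ↦ [e, y] K`, which agrees with `ad(E)` up to weight factors. -/
def raise (q : ℂˣ) (c₀ : ℂ) : A q c₀ →ₗ[ℂ] A q c₀ :=
  LinearMap.mulRight ℂ k ∘ₗ (LinearMap.mulLeft ℂ e - LinearMap.mulRight ℂ e)

theorem raise_apply (y : A q c₀) : raise q c₀ y = (e * y - y * e) * k := rfl

theorem f_pow_mul_k (n : ℕ) : f ^ n * k = ((q : ℂ) ^ 2) ^ n • (k * f ^ n : A q c₀) :=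
  pow_mul_of_mul_eq_smul f_mul_k n

theorem e_pow_mul_k (n : ℕ) : e ^ n * k = (((q : ℂ) ^ 2)⁻¹) ^ n • (k * e ^ n : A q c₀) :=
  pow_mul_of_mul_eq_smul e_mul_k n

theorem raise_e_pow (n : ℕ) : raise q c₀ (e ^ n) = 0 := by
  rw [raise_apply, ← pow_succ, ← pow_succ', sub_self, zero_mul]

-- Moving e to the right past R(x) replaces R by R(q²x), so the commutator has coefficient
-- polynomial R(q²x) - R(x). It has no constant term, so right multiplication by K = x⁻¹ lowers its
-- degree by one. The total degree D + n is kept when D > 0, and the leading coefficient is scaled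
-- by q^(2D) - 1 and a power of q. For D = 0 the result is 0, so the truncated D - 1 is harmless.
open Polynomial in
theorem raise_aeval_mul_e_pow (hq : ∀ n : ℕ, 0 < n → q ^ n ≠ 1) (n : ℕ) {D : ℕ} {R : ℂ[X]}
    (hR : R.natDegree ≤ D) : ∃ R' : ℂ[X], R'.natDegree ≤ D - 1 ∧
      (D ≠ 0 → R.coeff D ≠ 0 → R'.coeff (D - 1) ≠ 0) ∧
      raise q c₀ (aeval x R * e ^ n) = aeval x R' * e ^ (n + 1) := by
  have hc := q_sq_ne_zero q
  set S : ℂ[X] := R.comp (C ((q : ℂ) ^ 2) * X) - R with hS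
  have hS0 : ∀ j, S.coeff j = R.coeff j * (((q : ℂ) ^ 2) ^ j - 1) := by
    intro j
    rw [hS, coeff_sub, comp_C_mul_X_coeff]; ring
  refine ⟨C ((((q : ℂ) ^ 2)⁻¹) ^ (n + 1)) * S.divX, ?_, ?_, ?_⟩
  · refine natDegree_le_iff_coeff_eq_zero.2 fun j hj => ?_
    rw [coeff_C_mul, coeff_divX, hS0, coeff_eq_zero_of_natDegree_lt (by omega), zero_mul, mul_zero]
  · intro hD h
    rw [coeff_C_mul, coeff_divX, Nat.sub_add_cancel (Nat.pos_of_ne_zero hD), hS0]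
    refine mul_ne_zero (pow_ne_zero _ (inv_ne_zero hc)) (mul_ne_zero h (sub_ne_zero.2 ?_))
    rw [← pow_mul]
    exact pow_ne_one hq (by omega)
  · rw [raise_apply, ← mul_assoc, mul_aeval_of_mul_eq_smul e_mul_x, mul_assoc, mul_assoc,
      ← pow_succ, ← pow_succ', ← sub_mul, ← map_sub, ← hS, mul_assoc, e_pow_mul_k, mul_smul_comm,
      ← mul_assoc, aeval_mul_k (by rw [hS0]; simp), map_mul, aeval_C, ← Algebra.smul_def,
      smul_mul_assoc]

-- Below weight 0 the commutator replaces one f by a quadratic polynomial in x, and K then removes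
-- one power of x. Degree D thus becomes D + 1 while the power of f drops by one, so the total
-- degree is unchanged.
open Polynomial in
theorem raise_aeval_mul_f_pow (hq : ∀ n : ℕ, 0 < n → q ^ n ≠ 1) (n : ℕ) {D : ℕ} {R : ℂ[X]}
    (hR : R.natDegree ≤ D) : ∃ R' : ℂ[X], R'.natDegree ≤ D + 1 ∧
      (R.coeff D ≠ 0 → R'.coeff (D + 1) ≠ 0) ∧
      raise q c₀ (aeval x R * f ^ (n + 1)) = aeval x R' * f ^ n := by
  have hc := q_sq_ne_zero q
  have hq0 := q.ne_zero
  have hα := casimirScale_ne_zero hq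
  set P₁ : ℂ[X] := C ((q : ℂ) ^ 2 * c₀) * X - C (casimirScale q) *
    (C (q : ℂ) + C ((q : ℂ) ^ 3) * X ^ 2) with hP₁
  set P₂ : ℂ[X] := C c₀ * X - C (casimirScale q) *
    (C (q : ℂ) + C ((q : ℂ)⁻¹) * X ^ 2) with hP₂
  have h₁ : e * f = aeval (x : A q c₀) P₁ := by
    rw [e_mul_f hq, hP₁, aeval_quadratic]
  have h₂ : f * e = aeval (x : A q c₀) P₂ := by
    rw [f_mul_e, hP₂, aeval_quadratic]
  set p : ℂ := (((q : ℂ) ^ 2)⁻¹) ^ n with hp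
  have h₃ : f ^ n * aeval (x : A q c₀) P₂ = aeval x (P₂.comp (C p * X)) * f ^ n :=
    mul_aeval_of_mul_eq_smul (f_pow_mul_x n) P₂
  have d₁ : P₁.natDegree ≤ 2 := by rw [hP₁]; compute_degree
  have d₂ : P₂.natDegree ≤ 2 := by rw [hP₂]; compute_degree
  have d₃ : (P₂.comp (C p * X)).natDegree ≤ 2 :=
    natDegree_le_iff_coeff_eq_zero.2 fun j hj => by
      rw [comp_C_mul_X_coeff, coeff_eq_zero_of_natDegree_lt (by omega), zero_mul]
  have d₄ : (R.comp (C ((q : ℂ) ^ 2) * X)).natDegree ≤ D :=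
    natDegree_le_iff_coeff_eq_zero.2 fun j hj => by
      rw [comp_C_mul_X_coeff, coeff_eq_zero_of_natDegree_lt (by omega), zero_mul]
  set S : ℂ[X] := R.comp (C ((q : ℂ) ^ 2) * X) * P₁ - R * P₂.comp (C p * X) with hS
  -- The polynomials of ef and fe have the same constant term, so S is divisible by x and
  -- `aeval_mul_k` applies.
  have hS0 : S.coeff 0 = 0 := by
    rw [hS, coeff_sub, mul_coeff_zero, mul_coeff_zero, comp_C_mul_X_coeff, comp_C_mul_X_coeff,
      hP₁, hP₂]
    simp
  have dS : S.natDegree ≤ D + 2 := (natDegree_sub_le _ _).trans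
    (max_le (natDegree_mul_le_of_le d₄ d₁) (natDegree_mul_le_of_le hR d₃))
  have cS : S.coeff (D + 2) =
      R.coeff D * (-casimirScale q * (((q : ℂ) ^ 2) ^ D * (q : ℂ) ^ 3 - (q : ℂ)⁻¹ * p ^ 2)) := by
    rw [hS, coeff_sub, coeff_mul_add_eq_of_natDegree_le d₄ d₁, coeff_mul_add_eq_of_natDegree_le hR d₃,
      comp_C_mul_X_coeff, comp_C_mul_X_coeff, hP₁, hP₂, coeff_two_quadratic, coeff_two_quadratic]
    ring
  refine ⟨C (((q : ℂ) ^ 2) ^ n) * S.divX, ?_, ?_, ?_⟩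
  · refine natDegree_le_iff_coeff_eq_zero.2 fun j hj => ?_
    rw [coeff_C_mul, coeff_divX, coeff_eq_zero_of_natDegree_lt (by omega), mul_zero]
  · intro h
    rw [coeff_C_mul, coeff_divX, cS]
    refine mul_ne_zero (pow_ne_zero _ hc) (mul_ne_zero h (mul_ne_zero (neg_ne_zero.2 hα) ?_))
    intro h0
    -- The two contributions to the leading coefficient, from q^(2D+3) and q^(-4n-1), cancel only if
    -- q^(2D+4n+4) = 1.
    apply pow_ne_one hq (n := 2 * D + 4 * n + 4) (by omega)
    rw [hp] at h0
    simp only [inv_pow] at h0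
    field_simp at h0
    linear_combination h0
  · rw [raise_apply, ← mul_assoc, mul_aeval_of_mul_eq_smul e_mul_x, mul_assoc _ e, mul_assoc _ _ e,
      pow_succ f n, mul_assoc (f ^ n), h₂, ← pow_succ, pow_succ' f, ← mul_assoc e, h₁, h₃, ← mul_assoc, ← mul_assoc, ← map_mul, ← map_mul, ← sub_mul, ← map_sub, ← hS,
      mul_assoc, f_pow_mul_k, mul_smul_comm, ← mul_assoc, aeval_mul_k hS0, map_mul, aeval_C,
      ← Algebra.smul_def, smul_mul_assoc]

-- Each application of `raise` trades a power of x for a power of e without losing the leading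
-- coefficient. After D steps a nonzero constant times e^(D+n) is left.
open Polynomial in
theorem e_pow_mem_of_aeval_mul_e_pow_mem (hq : ∀ n : ℕ, 0 < n → q ^ n ≠ 1)
    {N : Submodule ℂ (A q c₀)} (hN : ∀ y ∈ N, raise q c₀ y ∈ N) (D : ℕ) :
    ∀ (n : ℕ) (R : ℂ[X]), R.natDegree ≤ D → R.coeff D ≠ 0 → aeval x R * e ^ n ∈ N →
      e ^ (D + n) ∈ N := by
  induction D with
  | zero =>
    intro n R hR h0 h
    rw [eq_C_of_natDegree_le_zero hR, aeval_C, ← Algebra.smul_def] at h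
    rw [zero_add]
    exact (Submodule.smul_mem_iff _ h0).1 h
  | succ D ih =>
    intro n R hR h0 h
    obtain ⟨R', h1, h2, h3⟩ := raise_aeval_mul_e_pow (c₀ := c₀) hq n hR
    have h4 := hN _ h
    rw [h3] at h4
    have := ih (n + 1) R' h1 (h2 (by omega) h0) h4
    rwa [show D + 1 + n = D + (n + 1) by omega]

open Polynomial in
theorem e_pow_mem_of_aeval_mul_f_pow_mem (hq : ∀ n : ℕ, 0 < n → q ^ n ≠ 1)
    {N : Submodule ℂ (A q c₀)} (hN : ∀ y ∈ N, raise q c₀ y ∈ N) (n : ℕ) :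
    ∀ (D : ℕ) (R : ℂ[X]), R.natDegree ≤ D → R.coeff D ≠ 0 → aeval x R * f ^ n ∈ N →
      e ^ (D + n) ∈ N := by
  induction n with
  | zero =>
    intro D R hR h0 h
    exact e_pow_mem_of_aeval_mul_e_pow_mem hq hN D 0 R hR h0 (by rwa [pow_zero] at h ⊢)
  | succ n ih =>
    intro D R hR h0 h
    obtain ⟨R', h1, h2, h3⟩ := raise_aeval_mul_f_pow (c₀ := c₀) hq n hR
    have h4 := hN _ h
    rw [h3] at h4
    have := ih (D + 1) R' h1 (h2 h0) h4
    rwa [show D + (n + 1) = D + 1 + n by omega]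

open Polynomial in
theorem aeval_mul_pow_mem {d n : ℕ} {R : ℂ[X]} (h : R.natDegree + n ≤ d) {z : A q c₀}
    (hz : ∀ b, b + n ≤ d → x ^ b * z ∈ monoSpan q c₀ d) : aeval x R * z ∈ monoSpan q c₀ d := by
  rw [aeval_eq_sum_range, Finset.sum_mul]
  refine sum_mem fun i hi => ?_
  rw [smul_mul_assoc]
  exact Submodule.smul_mem _ _ (hz i (by have := Finset.mem_range.1 hi; omega))

theorem raise_mem (hq : ∀ n : ℕ, 0 < n → q ^ n ≠ 1) {d : ℕ} {y : A q c₀}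
    (hy : y ∈ monoSpan q c₀ d) : raise q c₀ y ∈ monoSpan q c₀ d := by
  have key : ∀ b n, b + n ≤ d → raise q c₀ (x ^ b * e ^ n) ∈ monoSpan q c₀ d := by
    intro b n h
    rcases b with _ | b
    · rw [pow_zero, one_mul, raise_e_pow]; exact zero_mem _
    · obtain ⟨R', h1, -, h3⟩ := raise_aeval_mul_e_pow (c₀ := c₀) hq n
        (Polynomial.natDegree_X_pow_le (R := ℂ) (b + 1))
      rw [Polynomial.aeval_X_pow] at h3
      rw [h3]
      exact aeval_mul_pow_mem (n := n + 1) (by omega) fun b h => xe_mem h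
  refine map_mem_monoSpan _ key (fun b n h => ?_) hy
  rcases n with _ | n
  · have := key b 0 h
    rwa [pow_zero] at this ⊢
  · obtain ⟨R', h1, -, h3⟩ := raise_aeval_mul_f_pow (c₀ := c₀) hq n
      (Polynomial.natDegree_X_pow_le (R := ℂ) b)
    rw [Polynomial.aeval_X_pow] at h3
    rw [h3]
    exact aeval_mul_pow_mem (n := n) (by omega) fun b h => xf_mem h

/-! ## Weight decomposition -/

/-- The generator of weight `w`: `e^w` or `f^{-w}`. -/
def weightGen (q : ℂˣ) (c₀ : ℂ) : ℤ → A q c₀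
  | .ofNat n => e ^ n
  | .negSucc n => f ^ (n + 1)

/-- The part of weight `w` of `monoSpan q c₀ d`. -/
def weightSpan (q : ℂˣ) (c₀ : ℂ) (d : ℕ) (w : ℤ) : Submodule ℂ (A q c₀) :=
  Submodule.span ℂ {y | ∃ b, b + w.natAbs ≤ d ∧ y = x ^ b * weightGen q c₀ w}

theorem weightGen_neg (n : ℕ) : weightGen q c₀ (-n) = f ^ n := by
  rcases n with _ | n
  · change e ^ 0 = _; simp
  · rfl

theorem monoSpan_le_iSup (d : ℕ) : monoSpan q c₀ d ≤ ⨆ w, weightSpan q c₀ d w := by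
  rw [monoSpan, Submodule.span_le]
  rintro _ ⟨b, n, h, rfl | rfl⟩
  · exact Submodule.mem_iSup_of_mem (n : ℤ) (Submodule.subset_span ⟨b, by simpa using h, rfl⟩)
  · exact Submodule.mem_iSup_of_mem (-n : ℤ)
      (Submodule.subset_span ⟨b, by simpa using h, by rw [weightGen_neg]⟩)

theorem weightSpan_le (d : ℕ) (w : ℤ) : weightSpan q c₀ d w ≤ monoSpan q c₀ d := by
  rw [weightSpan, Submodule.span_le]
  rintro _ ⟨b, h, rfl⟩
  rcases w with n | n
  exacts [xe_mem (by simpa using h), xf_mem (by simpa using h)]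

theorem hasWeight_of_mem {d : ℕ} {w : ℤ} {y : A q c₀} (hy : y ∈ weightSpan q c₀ d w) :
    HasWeight w y := by
  induction hy using Submodule.span_induction with
  | mem y hy =>
    obtain ⟨b, -, rfl⟩ := hy
    rcases w with n | n
    exacts [hasWeight_xe b n, hasWeight_xf b (n + 1)]
  | zero => simp [HasWeight]
  | add a b _ _ ha hb =>
    rw [HasWeight] at *
    rw [mul_add, ha, hb, add_mul, smul_add]
  | smul c a _ ha =>
    rw [HasWeight] at *
    rw [mul_smul_comm, ha, smul_mul_assoc, smul_comm]

open Polynomial in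
theorem exists_aeval_of_mem {d : ℕ} {w : ℤ} {y : A q c₀} (hy : y ∈ weightSpan q c₀ d w) :
    ∃ R : ℂ[X], y = aeval x R * weightGen q c₀ w ∧ ∀ j, R.coeff j ≠ 0 → j + w.natAbs ≤ d := by
  induction hy using Submodule.span_induction with
  | mem y hy =>
    obtain ⟨b, hb, rfl⟩ := hy
    refine ⟨X ^ b, by simp, fun j hj => ?_⟩
    rw [coeff_X_pow] at hj
    have : j = b := by by_contra h; simp [h] at hj
    omega
  | zero => exact ⟨0, by simp, by simp⟩
  | add a b _ _ ha hb =>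
    obtain ⟨R, rfl, hR⟩ := ha
    obtain ⟨S, rfl, hS⟩ := hb
    refine ⟨R + S, by rw [map_add, add_mul], fun j hj => ?_⟩
    by_cases h : R.coeff j = 0
    · exact hS j fun h' => hj (by rw [coeff_add, h, h', add_zero])
    · exact hR j h
  | smul c a _ ha =>
    obtain ⟨R, rfl, hR⟩ := ha
    refine ⟨c • R, by rw [map_smul, smul_mul_assoc], fun j hj => hR j fun h => hj ?_⟩
    rw [coeff_smul, h, smul_zero]

-- This plays the part of finding a highest weight vector in an ad-stable subspace: the powers e^m
-- are the vectors reached, and m is the total degree of the weight vector one starts from.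
open Polynomial in
theorem exists_e_pow_mem_of_weightSpan (hq : ∀ n : ℕ, 0 < n → q ^ n ≠ 1)
    {N : Submodule ℂ (A q c₀)} (hN : ∀ y ∈ N, raise q c₀ y ∈ N) {d : ℕ} {w : ℤ} {y : A q c₀}
    (hy : y ∈ weightSpan q c₀ d w) (hyN : y ∈ N) (h0 : y ≠ 0) : ∃ m ≤ d, e ^ m ∈ N := by
  obtain ⟨R, rfl, hR⟩ := exists_aeval_of_mem hy
  have hR0 : R.coeff R.natDegree ≠ 0 := by
    intro h
    exact h0 (by rw [leadingCoeff_eq_zero.1 h]; simp)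
  refine ⟨R.natDegree + w.natAbs, hR _ hR0, ?_⟩
  rcases w with n | n
  · exact e_pow_mem_of_aeval_mul_e_pow_mem hq hN _ n R le_rfl hR0 hyN
  · exact e_pow_mem_of_aeval_mul_f_pow_mem hq hN (n + 1) _ R le_rfl hR0 hyN

/-! ## The radical of the trace form -/

/-- The left radical of the form `T(ab)` on `monoSpan q c₀ d`. -/
def radical (T : A q c₀ →ₗ[ℂ] ℂ) (d : ℕ) : Submodule ℂ (A q c₀) where
  carrier := {y | y ∈ monoSpan q c₀ d ∧ ∀ b ∈ monoSpan q c₀ d, T (y * b) = 0}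
  add_mem' := fun ⟨h1, h2⟩ ⟨h3, h4⟩ => ⟨add_mem h1 h3, fun b hb => by
    rw [add_mul, map_add, h2 b hb, h4 b hb, add_zero]⟩
  zero_mem' := ⟨zero_mem _, by simp⟩
  smul_mem' := fun c _ ⟨h1, h2⟩ => ⟨Submodule.smul_mem _ c h1, fun b hb => by
    rw [smul_mul_assoc, map_smul, h2 b hb, smul_zero]⟩

namespace IsTwistedTrace

variable {T : A q c₀ →ₗ[ℂ] ℂ} (hT : IsTwistedTrace q c₀ (q ^ 2)⁻¹ T)
include hT

/-- Integration by parts for the form. The factor q⁻² from moving e around the trace cancels the q²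
from moving K past e, which is where the twist t = q⁻² matters. -/
theorem raise_mul {w : ℤ} {b : A q c₀} (hb : HasWeight w b) (y : A q c₀) :
    T (raise q c₀ y * b) = -(((q : ℂ) ^ 2) ^ w * T (y * raise q c₀ b)) := by
  rw [HasWeight] at hb
  have h1 : T (e * y * k * b) = ((q : ℂ) ^ 2) ^ w * T (y * (b * e * k)) := by
    rw [mul_assoc, mul_assoc, hT.e_mul, hb, mul_smul_comm, smul_mul_assoc, map_smul, smul_eq_mul,
      mul_assoc y, mul_assoc b, k_mul_e, mul_smul_comm, mul_smul_comm, map_smul, smul_eq_mul,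
      mul_assoc b]
    have := q_sq_ne_zero q
    field_simp
  have h2 : T (y * e * k * b) = ((q : ℂ) ^ 2) ^ w * T (y * (e * b * k)) := by
    rw [mul_assoc, hb, mul_smul_comm, map_smul, smul_eq_mul]
    simp only [mul_assoc]
  rw [raise_apply, raise_apply, sub_mul, sub_mul, map_sub, h1, h2, sub_mul, mul_sub, map_sub]
  ring

theorem raise_mem_radical (hq : ∀ n : ℕ, 0 < n → q ^ n ≠ 1) {d : ℕ} {y : A q c₀}
    (hy : y ∈ radical T d) : raise q c₀ y ∈ radical T d := by
  refine ⟨raise_mem hq hy.1, fun b hb => ?_⟩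
  refine monoSpan_induction (p := fun b => T (raise q c₀ y * b) = 0) (by simp)
    (fun a b ha hb => by rw [mul_add, map_add, ha, hb, add_zero])
    (fun c a ha => by rw [mul_smul_comm, map_smul, ha, smul_zero]) (fun b n h => ?_)
    (fun b n h => ?_) hb
  · rw [hT.raise_mul (hasWeight_xe b n), hy.2 _ (raise_mem hq (xe_mem h)), mul_zero, neg_zero]
  · rw [hT.raise_mul (hasWeight_xf b n), hy.2 _ (raise_mem hq (xf_mem h)), mul_zero, neg_zero]

/-- The form pairs weight w only with weight -w, so the radical contains the weight components of
its elements. A nonzero component is then raised to a power of e inside the radical. -/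
theorem exists_e_pow_mem_radical (hq : ∀ n : ℕ, 0 < n → q ^ n ≠ 1) {d : ℕ} {y : A q c₀}
    (hy : y ∈ radical T d) (h0 : y ≠ 0) : ∃ m ≤ d, e ^ m ∈ radical T d := by
  obtain ⟨Y, hY, hsum⟩ := (Submodule.mem_iSup_iff_exists_finsupp _ _).1 (monoSpan_le_iSup d hy.1)
  have hrad : ∀ w, Y w ∈ radical T d := by
    intro w
    refine ⟨weightSpan_le d w (hY w), fun b hb => ?_⟩
    refine Submodule.iSup_induction (weightSpan q c₀ d) (motive := fun b => T (Y w * b) = 0)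
      (monoSpan_le_iSup d hb) (fun v b hb => ?_) (by simp)
      (fun a b ha hb => by rw [mul_add, map_add, ha, hb, add_zero])
    -- When v = -w, pairing with b isolates the component `Y w`, since all others pair to zero by
    -- weight.
    by_cases hvw : w + v = 0
    · have h1 := hy.2 b (weightSpan_le d v hb)
      rw [← hsum, Finsupp.sum, Finset.sum_mul, map_sum, Finset.sum_eq_single w] at h1
      · exact h1
      · intro u _ hu
        exact hT.eq_zero_of_hasWeight hq (w := u + v) (by omega)
          ((hasWeight_of_mem (hY u)).mul (hasWeight_of_mem hb))
      · intro hw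
        rw [Finsupp.notMem_support_iff.1 hw, zero_mul, map_zero]
    · exact hT.eq_zero_of_hasWeight hq hvw ((hasWeight_of_mem (hY w)).mul (hasWeight_of_mem hb))
  have : ∃ w, Y w ≠ 0 := by
    by_contra! h
    apply h0
    rw [← hsum]
    exact Finset.sum_eq_zero fun w _ => h w
  obtain ⟨w, hw⟩ := this
  exact exists_e_pow_mem_of_weightSpan hq (fun y hy => hT.raise_mem_radical hq hy) (hY w)
    (hrad w) hw

-- Since e^m is annihilated by `raise`, integration by parts makes it orthogonal to every `raise q
-- c₀ (x ^ D * f ^ (m + 1))`. These have the form R'(x) f^m with R' of exact degree D + 1, so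
-- together with f^m they span all polynomial multiples of f^m.
open Polynomial in
theorem e_pow_mul_aeval_mul_f_pow (hq : ∀ n : ℕ, 0 < n → q ^ n ≠ 1) {m : ℕ}
    (h : T (e ^ m * f ^ m) = 0) (D : ℕ) :
    ∀ R : ℂ[X], R.natDegree ≤ D → T (e ^ m * (aeval x R * f ^ m)) = 0 := by
  induction D with
  | zero =>
    intro R hR
    rw [eq_C_of_natDegree_le_zero hR, aeval_C, ← Algebra.smul_def, mul_smul_comm, map_smul, h,
      smul_zero]
  | succ D ih =>
    intro R hR
    obtain ⟨R', h1, h2, h3⟩ := raise_aeval_mul_f_pow (c₀ := c₀) hq m (natDegree_X_pow_le (R := ℂ) D)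
    have h4 : T (e ^ m * (aeval x R' * f ^ m)) = 0 := by
      have h5 := hT.raise_mul (hasWeight_xf D (m + 1)) (e ^ m)
      rw [raise_e_pow, zero_mul, map_zero] at h5
      rw [← h3, aeval_X_pow]
      exact (mul_eq_zero.1 (neg_eq_zero.1 h5.symm)).resolve_left (zpow_ne_zero _ (q_sq_ne_zero q))
    have h6 : R'.coeff (D + 1) ≠ 0 := h2 (by simp)
    -- The multiple of R' is chosen to cancel the coefficient of degree D + 1, so that the remainder
    -- falls under the induction hypothesis.
    have h7 := ih (R - C (R.coeff (D + 1) / R'.coeff (D + 1)) * R') (by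
      refine natDegree_le_iff_coeff_eq_zero.2 fun j hj => ?_
      rw [coeff_sub, coeff_C_mul]
      rcases eq_or_ne j (D + 1) with rfl | hj'
      · field_simp; ring
      · have hj2 : D + 1 < j := by omega
        rw [coeff_eq_zero_of_natDegree_lt (hR.trans_lt hj2),
          coeff_eq_zero_of_natDegree_lt (h1.trans_lt hj2), mul_zero, sub_zero])
    rw [map_sub, map_mul (aeval x), aeval_C, ← Algebra.smul_def, sub_mul, smul_mul_assoc, mul_sub,
      mul_smul_comm, map_sub, map_smul, h4, smul_zero, sub_zero] at h7
    exact h7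

theorem e_pow_mul_eq_zero (hq : ∀ n : ℕ, 0 < n → q ^ n ≠ 1) {m : ℕ} (hm : m ≠ 0)
    (h : T (e ^ m * f ^ m) = 0) {a : A q c₀} (ha : a ∈ APlus q c₀) : T (e ^ m * a) = 0 := by
  obtain ⟨d, ha⟩ := exists_mem_monoSpan hq ha
  refine monoSpan_induction (p := fun a => T (e ^ m * a) = 0) (by simp)
    (fun a b ha hb => by rw [mul_add, map_add, ha, hb, add_zero])
    (fun c a ha => by rw [mul_smul_comm, map_smul, ha, smul_zero]) (fun b n _ => ?_)
    (fun b n _ => ?_) ha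
  · exact hT.eq_zero_of_hasWeight hq (by omega) ((hasWeight_e.pow m).mul (hasWeight_xe b n))
  · rcases eq_or_ne n m with rfl | hn
    · simpa using hT.e_pow_mul_aeval_mul_f_pow hq h b (Polynomial.X ^ b)
        (Polynomial.natDegree_X_pow_le b)
    · exact hT.eq_zero_of_hasWeight hq (by omega) ((hasWeight_e.pow m).mul (hasWeight_xf b n))

theorem f_pow_mul (m : ℕ) (a : A q c₀) : T (f ^ m * a) = ((q : ℂ) ^ 2) ^ m * T (a * f ^ m) := by
  induction m generalizing a with
  | zero => simp
  | succ m ih =>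
    rw [pow_succ', mul_assoc, hT.f_mul, mul_assoc, ih, mul_assoc, ← mul_assoc, ← pow_succ']

theorem x_pow_mul (m : ℕ) (a : A q c₀) : T (x ^ m * a) = T (a * x ^ m) := by
  induction m generalizing a with
  | zero => simp
  | succ m ih => rw [pow_succ', mul_assoc, hT.x_mul, mul_assoc, ih, mul_assoc]

/-- By weight only the pairing with x^b e^m matters. Cycling f^m and x^b around the trace turns it
into a multiple of T(e^m f^m x^b), which is already known to vanish. -/
theorem f_pow_mul_eq_zero (hq : ∀ n : ℕ, 0 < n → q ^ n ≠ 1) {m : ℕ} (hm : m ≠ 0)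
    (h : T (e ^ m * f ^ m) = 0) {a : A q c₀} (ha : a ∈ APlus q c₀) : T (f ^ m * a) = 0 := by
  obtain ⟨d, ha⟩ := exists_mem_monoSpan hq ha
  refine monoSpan_induction (p := fun a => T (f ^ m * a) = 0) (by simp)
    (fun a b ha hb => by rw [mul_add, map_add, ha, hb, add_zero])
    (fun c a ha => by rw [mul_smul_comm, map_smul, ha, smul_zero]) (fun b n _ => ?_)
    (fun b n _ => ?_) ha
  · rcases eq_or_ne n m with rfl | hn
    · rw [hT.f_pow_mul, mul_assoc, hT.x_pow_mul, mul_assoc,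
        hT.e_pow_mul_eq_zero hq hm h (mul_mem (pow_mem f_mem _) (pow_mem x_mem _)), mul_zero]
    · exact hT.eq_zero_of_hasWeight hq (by omega) ((hasWeight_f.pow m).mul (hasWeight_xe b n))
  · exact hT.eq_zero_of_hasWeight hq (by omega) ((hasWeight_f.pow m).mul (hasWeight_xf b n))

end IsTwistedTrace

-- Peeling off the innermost fe multiplies the constant term by that of the quadratic polynomial,
-- which is nonzero. The nonvanishing of Q(0) is what later makes K⁻¹ invertible on the quotient of
-- 𝒜₊.
open Polynomial in
theorem exists_f_pow_mul_e_pow (hq : ∀ n : ℕ, 0 < n → q ^ n ≠ 1) (m : ℕ) :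
    ∃ Q : ℂ[X], Q.coeff 0 ≠ 0 ∧ f ^ m * e ^ m = aeval (x : A q c₀) Q := by
  induction m with
  | zero => exact ⟨1, by simp, by simp⟩
  | succ m ih =>
    obtain ⟨Q, h0, hQ⟩ := ih
    refine ⟨Q.comp (C (((q : ℂ) ^ 2)⁻¹) * X) * (C c₀ * X - C (casimirScale q) *
      (C (q : ℂ) + C ((q : ℂ)⁻¹) * X ^ 2)), ?_, ?_⟩
    · rw [mul_coeff_zero, comp_C_mul_X_coeff]
      simp [h0, casimirScale_ne_zero hq]
    · rw [pow_succ', pow_succ, mul_assoc, ← mul_assoc (f ^ m), hQ, ← mul_assoc,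
        mul_aeval_of_mul_eq_smul f_mul_x, mul_assoc, f_mul_e]
      simp [Algebra.algebraMap_eq_smul_one]

/-! ## Representations from representations of `𝒜₊` -/

/-- A homomorphism out of `𝒜` from images of `K`, `K⁻¹`, `EK⁻¹`, `F`. -/
theorem exists_algHom_map_eq (hq : ∀ n : ℕ, 0 < n → q ^ n ≠ 1) {B : Type*} [Ring B] [Algebra ℂ B]
    {K X Y Z : B} (hKX : K * X = 1) (hXK : X * K = 1) (hYX : Y * X = (q : ℂ) ^ 2 • (X * Y))
    (hZX : Z * X = ((q : ℂ) ^ 2)⁻¹ • (X * Z))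
    (hYZ : Y * Z = ((q : ℂ) ^ 2 * c₀) • X -
      casimirScale q • ((q : ℂ) • 1 + (q : ℂ) ^ 3 • X ^ 2))
    (hZY : Z * Y = c₀ • X - casimirScale q • ((q : ℂ) • 1 + (q : ℂ)⁻¹ • X ^ 2)) :
    ∃ φ : A q c₀ →ₐ[ℂ] B, φ k = K ∧ φ x = X ∧ φ e = Y ∧ φ f = Z := by
  have hq0 := q.ne_zero
  have hq1 := q_sub_inv_ne_zero hq
  have hX2K : X ^ 2 * K = X := by rw [pow_two, mul_assoc, hXK, mul_one]
  have hKY : K * Y = (q : ℂ) ^ 2 • (Y * K) := by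
    have : K * (Y * X) * K = (q : ℂ) ^ 2 • (K * X * Y * K) := by
      rw [hYX, mul_smul_comm, smul_mul_assoc, ← mul_assoc K X]
    rwa [hKX, one_mul, ← mul_assoc, mul_assoc _ X, hXK, mul_one] at this
  have hKZ : K * Z = ((q : ℂ) ^ 2)⁻¹ • (Z * K) := by
    have : K * (Z * X) * K = ((q : ℂ) ^ 2)⁻¹ • (K * X * Z * K) := by
      rw [hZX, mul_smul_comm, smul_mul_assoc, ← mul_assoc K X]
    rwa [hKX, one_mul, ← mul_assoc, mul_assoc _ X, hXK, mul_one] at this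
  let v : Gen → B := fun
    | .E => Y * K
    | .F => Z
    | .K => K
    | .Kinv => X
  have hv : ∀ x, FreeAlgebra.lift ℂ v (gen x) = v x := fun x => FreeAlgebra.lift_ι_apply _ _
  let φ : Uq q →ₐ[ℂ] B := Uq.lift q (FreeAlgebra.lift ℂ v) (by
    intro a b h
    cases h <;> simp only [map_mul, map_sub, map_smul, map_one, hv, v]
    · exact hKX
    · exact hXK
    · rw [mul_assoc, mul_assoc, hKX, mul_one, hKY]
    · rw [hKZ, smul_mul_assoc, mul_assoc, hKX, mul_one]
    · rw [mul_assoc, hKZ, mul_smul_comm, ← mul_assoc, hYZ, ← mul_assoc, hZY]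
      simp only [sub_mul, add_mul, smul_mul_assoc, one_mul, hXK, hX2K]
      have h2 : ((q : ℂ) - (q : ℂ)⁻¹)⁻¹ = casimirScale q * ((q : ℂ) - (q : ℂ)⁻¹) := by
        rw [casimirScale]; field_simp
      rw [h2]
      match_scalars <;> field_simp <;> ring)
  have hφ : ∀ x, φ (Uq.of q x) = v x := fun x => by
    rw [Uq.of, Uq.lift_mk, hv]
  let ψ : A q c₀ →ₐ[ℂ] B := A.lift q c₀ φ (by
    intro a b h
    cases h
    rw [casimir, AlgHom.commutes, map_add, map_mul, map_smul, map_add, map_smul, map_smul,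
      hφ, hφ, hφ, hφ, Algebra.algebraMap_eq_smul_one]
    change Z * (Y * K) + _ • ((q : ℂ) • K + (q : ℂ)⁻¹ • X) = _
    rw [← mul_assoc, hZY]
    simp only [sub_mul, add_mul, smul_mul_assoc, one_mul, hXK, hX2K]
    rw [casimirScale]
    module)
  have hψ : ∀ x, ψ (A.of q c₀ x) = v x := fun x => by
    rw [A.of, A.lift_mk, hφ]
  refine ⟨ψ, hψ .K, hψ .Kinv, ?_, hψ .F⟩
  rw [e, map_mul, hψ, hψ, mul_assoc, hKX, mul_one]

theorem g_mem_APlus (t : ℂˣ) {a : A q c₀} (ha : a ∈ APlus q c₀) : g q c₀ t a ∈ APlus q c₀ := by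
  suffices h : APlus q c₀ ≤ (APlus q c₀).comap (g q c₀ t) from h ha
  refine Algebra.adjoin_le ?_
  rintro _ (rfl | rfl | rfl) <;> rw [SetLike.mem_coe, Subalgebra.mem_comap]
  · rw [g_of]; exact Subalgebra.smul_mem _ f_mem _
  · rw [g_of]; exact Subalgebra.smul_mem _ x_mem _
  · rw [map_mul, g_of, g_of, smul_mul_smul_comm]; exact Subalgebra.smul_mem _ e_mem _

/-- The left kernel of the form `T(ab)` on `𝒜₊`, as a left ideal. -/
def kernelIdeal {T : A q c₀ →ₗ[ℂ] ℂ} (hT : IsTwistedTrace q c₀ (q ^ 2)⁻¹ T) :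
    Submodule (APlus q c₀) (APlus q c₀) where
  carrier := {a | ∀ b : APlus q c₀, T (a * b) = 0}
  add_mem' := fun h1 h2 b => by
    rw [Subalgebra.coe_add, add_mul, map_add, h1 b, h2 b, add_zero]
  zero_mem' := by simp
  smul_mem' := fun c a h b => by
    -- The twisted trace property moves the left factor c to the right as g(c), which is again in
    -- 𝒜₊; this gives closure under left multiplication.
    rw [smul_eq_mul, Subalgebra.coe_mul, mul_assoc, hT, mul_assoc]
    exact h ⟨b * g q c₀ _ c, mul_mem b.2 (g_mem_APlus _ c.2)⟩

theorem mul_mem_kernelIdeal {T : A q c₀ →ₗ[ℂ] ℂ} (hT : IsTwistedTrace q c₀ (q ^ 2)⁻¹ T)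
    {a : APlus q c₀} (ha : a ∈ kernelIdeal hT) (b : APlus q c₀) : a * b ∈ kernelIdeal hT := by
  intro c
  rw [Subalgebra.coe_mul, mul_assoc]
  exact ha (b * c)

/-- `K⁻¹` in `𝒜₊`. -/
def xPlus (q : ℂˣ) (c₀ : ℂ) : APlus q c₀ := ⟨x, x_mem⟩

/-- `EK⁻¹` in `𝒜₊`. -/
def ePlus (q : ℂˣ) (c₀ : ℂ) : APlus q c₀ := ⟨e, e_mem⟩

/-- `F` in `𝒜₊`. -/
def fPlus (q : ℂˣ) (c₀ : ℂ) : APlus q c₀ := ⟨f, f_mem⟩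

theorem APlus_induction (hq : ∀ n : ℕ, 0 < n → q ^ n ≠ 1) {p : APlus q c₀ → Prop} (zero : p 0)
    (add : ∀ a b, p a → p b → p (a + b)) (smul : ∀ (c : ℂ) a, p a → p (c • a))
    (he : ∀ b n, p (xPlus q c₀ ^ b * ePlus q c₀ ^ n))
    (hf : ∀ b n, p (xPlus q c₀ ^ b * fPlus q c₀ ^ n)) (a : APlus q c₀) : p a := by
  obtain ⟨a, ha⟩ := a
  obtain ⟨d, hd⟩ := exists_mem_monoSpan hq ha
  have := monoSpan_induction (p := fun a => ∃ ha, p ⟨a, ha⟩) ⟨zero_mem _, zero⟩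
    (fun a b ⟨ha, h⟩ ⟨hb, h'⟩ => ⟨add_mem ha hb, add _ _ h h'⟩)
    (fun c a ⟨ha, h⟩ => ⟨Subalgebra.smul_mem _ ha c, smul c _ h⟩)
    (fun b n _ => ⟨_, he b n⟩) (fun b n _ => ⟨_, hf b n⟩) hd
  exact this.2

open Polynomial in
theorem aeval_xPlus (R : ℂ[X]) : ((aeval (xPlus q c₀) R : APlus q c₀) : A q c₀) = aeval x R :=
  (aeval_algHom_apply (APlus q c₀).val (xPlus q c₀) R).symm

-- Modulo the ideal, powers of e and f from the m-th on vanish, and powers of x reduce by Euclidean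
-- division by Q. Finitely many monomials survive.
open Polynomial in
theorem finite_quotient (hq : ∀ n : ℕ, 0 < n → q ^ n ≠ 1) {N : Submodule (APlus q c₀) (APlus q c₀)}
    (hN : ∀ a ∈ N, ∀ b, a * b ∈ N) {m : ℕ} (he : ePlus q c₀ ^ m ∈ N) (hf : fPlus q c₀ ^ m ∈ N)
    {Q : ℂ[X]} (hQ0 : Q ≠ 0) (hQ : aeval (xPlus q c₀) Q ∈ N) :
    FiniteDimensional ℂ (APlus q c₀ ⧸ N) := by
  let π : APlus q c₀ →ₗ[ℂ] APlus q c₀ ⧸ N := N.mkQ.restrictScalars ℂ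
  have hNl : ∀ c, ∀ a ∈ N, c * a ∈ N := fun c a ha => N.smul_mem c ha
  have hπ : ∀ a ∈ N, π a = 0 := fun a ha => (Submodule.Quotient.mk_eq_zero N).2 ha
  set s : Set (APlus q c₀ ⧸ N) :=
    (fun p : (ℕ × ℕ) => π (xPlus q c₀ ^ p.1 * ePlus q c₀ ^ p.2)) ''
      (Set.Iic Q.natDegree ×ˢ Set.Iio m) ∪
    (fun p : (ℕ × ℕ) => π (xPlus q c₀ ^ p.1 * fPlus q c₀ ^ p.2)) ''
      (Set.Iic Q.natDegree ×ˢ Set.Iio m) with hs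
  have hfin : s.Finite := (((Set.finite_Iic _).prod (Set.finite_Iio _)).image _).union
    (((Set.finite_Iic _).prod (Set.finite_Iio _)).image _)
  have key : ∀ z : APlus q c₀, (∀ b ≤ Q.natDegree, π (xPlus q c₀ ^ b * z) ∈ Submodule.span ℂ s) →
      ∀ b, π (xPlus q c₀ ^ b * z) ∈ Submodule.span ℂ s := by
    intro z hz b
    have h1 : (X ^ b : ℂ[X]) = (X ^ b / Q) * Q + X ^ b % Q := by
      rw [mul_comm]; exact (EuclideanDomain.div_add_mod _ _).symm
    have h2 : xPlus q c₀ ^ b = aeval (xPlus q c₀) (X ^ b / Q) * aeval (xPlus q c₀) Q +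
        aeval (xPlus q c₀) (X ^ b % Q) := by
      rw [← map_mul, ← map_add, ← h1, aeval_X_pow]
    rw [h2, add_mul, map_add, mul_assoc, hπ _ (hNl _ _ (hN _ hQ z)), zero_add,
      aeval_eq_sum_range, Finset.sum_mul, map_sum]
    refine sum_mem fun i hi => ?_
    rw [smul_mul_assoc, map_smul]
    refine Submodule.smul_mem _ _ (hz i ?_)
    have h3 : (X ^ b % Q).natDegree ≤ Q.natDegree :=
      natDegree_le_natDegree (degree_mod_lt _ hQ0).le
    have := Finset.mem_range.1 hi
    omega
  have htop : Submodule.span ℂ s = ⊤ := by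
    refine Submodule.eq_top_iff'.2 fun v => ?_
    obtain ⟨a, rfl⟩ := Submodule.Quotient.mk_surjective N v
    change π a ∈ _
    induction a using APlus_induction hq with
    | zero => rw [map_zero]; exact zero_mem _
    | add a b ha hb => rw [map_add]; exact add_mem ha hb
    | smul c a ha => rw [map_smul]; exact Submodule.smul_mem _ _ ha
    | he b n =>
      rcases lt_or_ge n m with h | h
      · exact key _ (fun b hb => Submodule.subset_span (Or.inl ⟨(b, n), ⟨hb, h⟩, rfl⟩)) b
      · obtain ⟨n, rfl⟩ := Nat.exists_eq_add_of_le' h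
        rw [pow_add, ← mul_assoc, hπ _ (hNl _ _ he)]
        exact zero_mem _
    | hf b n =>
      rcases lt_or_ge n m with h | h
      · exact key _ (fun b hb => Submodule.subset_span (Or.inr ⟨(b, n), ⟨hb, h⟩, rfl⟩)) b
      · obtain ⟨n, rfl⟩ := Nat.exists_eq_add_of_le' h
        rw [pow_add, ← mul_assoc, hπ _ (hNl _ _ hf)]
        exact zero_mem _
  exact ⟨htop ▸ Submodule.fg_span hfin⟩

/-- A homomorphism out of `𝒜₊` that inverts `K⁻¹` gives a homomorphism out of `𝒜`. -/
theorem exists_algHom_of_APlus (hq : ∀ n : ℕ, 0 < n → q ^ n ≠ 1) {B : Type*} [Ring B]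
    [Algebra ℂ B] (L : APlus q c₀ →ₐ[ℂ] B) {K : B} (hKX : K * L (xPlus q c₀) = 1)
    (hXK : L (xPlus q c₀) * K = 1) : Nonempty (A q c₀ →ₐ[ℂ] B) := by
  suffices h : ∃ φ : A q c₀ →ₐ[ℂ] B, φ k = K ∧ φ x = L (xPlus q c₀) ∧ φ e = L (ePlus q c₀) ∧
      φ f = L (fPlus q c₀) from ⟨h.choose⟩
  apply exists_algHom_map_eq hq hKX hXK
  all_goals simp only [← map_mul, ← map_pow, ← map_smul, ← map_one L, ← map_sub, ← map_add]
  all_goals refine congrArg L (Subtype.ext ?_)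
  exacts [e_mul_x, f_mul_x, e_mul_f hq, f_mul_e]

-- If Q(X) = 0 and Q(0) ≠ 0, then X has inverse -Q(0)⁻¹ (Q(X) - Q(0))/X, the quotient being formed
-- as a polynomial.
open Polynomial in
theorem exists_inverse_of_map_aeval_eq_zero {R B : Type*} [Ring R] [Algebra ℂ R] [Ring B]
    [Algebra ℂ B] {r : R} {Q : ℂ[X]} (hQ0 : Q.coeff 0 ≠ 0) (L : R →ₐ[ℂ] B)
    (h : L (aeval r Q) = 0) : ∃ K, K * L r = 1 ∧ L r * K = 1 := by
  rw [← aeval_algHom_apply] at h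
  set X := L r
  have hcomm : aeval X Q.divX * X = X * aeval X Q.divX := by
    have := congrArg (aeval X) (mul_comm Q.divX Polynomial.X)
    rwa [map_mul, map_mul, aeval_X] at this
  have hinv : (-(Q.coeff 0)⁻¹) • (aeval X Q.divX * X) = 1 := by
    rw [← divX_mul_X_add Q, map_add, map_mul, aeval_X, aeval_C,
      Algebra.algebraMap_eq_smul_one] at h
    rw [eq_neg_of_add_eq_zero_left h, smul_neg, neg_smul, neg_neg, smul_smul,
      inv_mul_cancel₀ hQ0, one_smul]
  exact ⟨(-(Q.coeff 0)⁻¹) • aeval X Q.divX, by rw [smul_mul_assoc, hinv],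
    by rw [mul_smul_comm, ← hcomm, hinv]⟩

-- The representation is 𝒜₊ modulo the kernel of the form, with K acting as the inverse of x. It is
-- nonzero because 1 in the kernel would force T(1) = 0.
open Polynomial in
theorem hasFiniteDimensionalRep_of_trace_eq_zero (hq : ∀ n : ℕ, 0 < n → q ^ n ≠ 1)
    {T : A q c₀ →ₗ[ℂ] ℂ} (hT : IsInvariantTrace q c₀ T) {m : ℕ} (hm : m ≠ 0)
    (h : T (e ^ m * f ^ m) = 0) : HasFiniteDimensionalRep (A q c₀) := by
  set N := kernelIdeal hT.1 with hN
  have he : ePlus q c₀ ^ m ∈ N := fun b => hT.1.e_pow_mul_eq_zero hq hm h b.2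
  have hf : fPlus q c₀ ^ m ∈ N := fun b => hT.1.f_pow_mul_eq_zero hq hm h b.2
  obtain ⟨Q, hQ0, hQ⟩ := exists_f_pow_mul_e_pow (c₀ := c₀) hq m
  have hQN : aeval (xPlus q c₀) Q ∈ N := by
    have : aeval (xPlus q c₀) Q = fPlus q c₀ ^ m * ePlus q c₀ ^ m :=
      Subtype.ext (by rw [aeval_xPlus, ← hQ]; rfl)
    rw [this]
    exact N.smul_mem _ he
  have hfd : FiniteDimensional ℂ (APlus q c₀ ⧸ N) :=
    finite_quotient hq (fun a ha b => mul_mem_kernelIdeal hT.1 ha b) he hf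
      (by rintro rfl; simp at hQ0) hQN
  have hnt : Nontrivial (APlus q c₀ ⧸ N) := by
    refine Submodule.Quotient.nontrivial_iff.2 fun htop => hT.one_ne_zero hq ?_
    have h1 : (1 : APlus q c₀) ∈ N := htop ▸ Submodule.mem_top
    simpa using h1 1
  let L : APlus q c₀ →ₐ[ℂ] Module.End ℂ (APlus q c₀ ⧸ N) := Algebra.lsmul ℂ ℂ _
  have hLQ : L (aeval (xPlus q c₀) Q) = 0 := by
    refine LinearMap.ext fun v => ?_
    obtain ⟨a, rfl⟩ := Submodule.Quotient.mk_surjective N v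
    exact (Submodule.Quotient.mk_eq_zero N).2 (mul_mem_kernelIdeal hT.1 hQN a)
  obtain ⟨K, hKX, hXK⟩ := exists_inverse_of_map_aeval_eq_zero hQ0 L hLQ
  exact ⟨APlus q c₀ ⧸ N, _, _, hfd, hnt, exists_algHom_of_APlus hq L hKX hXK⟩

/-! ## Existence of the twisted trace -/

/-- An action of `𝒜` on functions on `ℤ × ℤ`; `Ψ n j` plays the role of `ψ(K^j e^n)` for a linear
functional `ψ`, on which `a` acts by `(aψ)(y) = ψ(ya)`. -/
theorem exists_functionRep (hq : ∀ n : ℕ, 0 < n → q ^ n ≠ 1) (c₀ : ℂ) :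
    ∃ φ : A q c₀ →ₐ[ℂ] Module.End ℂ (ℤ → ℤ → ℂ),
      (∀ Ψ n j, φ k Ψ n j = (((q : ℂ) ^ 2) ^ n)⁻¹ * Ψ n (j + 1)) ∧
      (∀ Ψ n j, φ x Ψ n j = ((q : ℂ) ^ 2) ^ n * Ψ n (j - 1)) ∧
      (∀ Ψ n j, φ e Ψ n j = Ψ (n + 1) j) ∧
      (∀ Ψ n j, φ f Ψ n j = c₀ * ((q : ℂ) ^ 2) ^ n * Ψ (n - 1) (j - 1) - casimirScale q *
        ((q : ℂ) * Ψ (n - 1) j + (q : ℂ)⁻¹ * (((q : ℂ) ^ 2) ^ n) ^ 2 * Ψ (n - 1) (j - 2))) := by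
  have hu := q_sq_ne_zero q
  have hun : ∀ n : ℤ, ((q : ℂ) ^ 2) ^ n ≠ 0 := fun n => zpow_ne_zero n hu
  have hq0 := q.ne_zero
  let K : Module.End ℂ (ℤ → ℤ → ℂ) :=
    { toFun := fun Ψ n j => (((q : ℂ) ^ 2) ^ n)⁻¹ * Ψ n (j + 1)
      map_add' := fun Ψ Φ => by ext n j; simp only [Pi.add_apply]; ring
      map_smul' := fun c Ψ => by
        ext n j; simp only [Pi.smul_apply, smul_eq_mul, RingHom.id_apply]; ring }
  let X : Module.End ℂ (ℤ → ℤ → ℂ) :=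
    { toFun := fun Ψ n j => ((q : ℂ) ^ 2) ^ n * Ψ n (j - 1)
      map_add' := fun Ψ Φ => by ext n j; simp only [Pi.add_apply]; ring
      map_smul' := fun c Ψ => by
        ext n j; simp only [Pi.smul_apply, smul_eq_mul, RingHom.id_apply]; ring }
  let Y : Module.End ℂ (ℤ → ℤ → ℂ) :=
    { toFun := fun Ψ n j => Ψ (n + 1) j
      map_add' := fun Ψ Φ => by ext n j; simp only [Pi.add_apply]
      map_smul' := fun c Ψ => by
        ext n j; simp only [Pi.smul_apply, smul_eq_mul, RingHom.id_apply] }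
  -- The formula comes from writing f = (fe)e⁻¹ with fe quadratic in x. Here e acts as an invertible
  -- shift in n, which is why n ranges over ℤ.
  let Z : Module.End ℂ (ℤ → ℤ → ℂ) :=
    { toFun := fun Ψ n j => c₀ * ((q : ℂ) ^ 2) ^ n * Ψ (n - 1) (j - 1) - casimirScale q *
        ((q : ℂ) * Ψ (n - 1) j + (q : ℂ)⁻¹ * (((q : ℂ) ^ 2) ^ n) ^ 2 * Ψ (n - 1) (j - 2))
      map_add' := fun Ψ Φ => by ext n j; simp only [Pi.add_apply]; ring
      map_smul' := fun c Ψ => by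
        ext n j; simp only [Pi.smul_apply, smul_eq_mul, RingHom.id_apply]; ring }
  have hK : ∀ Ψ n j, K Ψ n j = (((q : ℂ) ^ 2) ^ n)⁻¹ * Ψ n (j + 1) := fun _ _ _ => rfl
  have hX : ∀ Ψ n j, X Ψ n j = ((q : ℂ) ^ 2) ^ n * Ψ n (j - 1) := fun _ _ _ => rfl
  have hY : ∀ Ψ n j, Y Ψ n j = Ψ (n + 1) j := fun _ _ _ => rfl
  have hZ : ∀ Ψ n j, Z Ψ n j = c₀ * ((q : ℂ) ^ 2) ^ n * Ψ (n - 1) (j - 1) - casimirScale q *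
        ((q : ℂ) * Ψ (n - 1) j + (q : ℂ)⁻¹ * (((q : ℂ) ^ 2) ^ n) ^ 2 * Ψ (n - 1) (j - 2)) :=
    fun _ _ _ => rfl
  suffices h : ∃ φ : A q c₀ →ₐ[ℂ] Module.End ℂ (ℤ → ℤ → ℂ), φ k = K ∧ φ x = X ∧ φ e = Y ∧
      φ f = Z by
    obtain ⟨φ, h1, h2, h3, h4⟩ := h
    refine ⟨φ, ?_, ?_, ?_, ?_⟩
    · rw [h1]; exact hK
    · rw [h2]; exact hX
    · rw [h3]; exact hY
    · rw [h4]; exact hZ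
  clear_value K X Y Z
  refine exists_algHom_map_eq hq ?_ ?_ ?_ ?_ ?_ ?_
  all_goals
    refine LinearMap.ext fun Ψ => ?_
    ext n j
    simp only [Module.End.mul_apply, Module.End.one_apply, LinearMap.sub_apply,
      LinearMap.add_apply, LinearMap.smul_apply, Pi.sub_apply, Pi.add_apply, Pi.smul_apply,
      smul_eq_mul, pow_two X, hK, hX, hY, hZ, add_sub_cancel_right, sub_add_cancel,
      zpow_add_one₀ hu, zpow_sub_one₀ hu, sub_sub, one_add_one_eq_two, add_comm (1 : ℤ) 2]
  · field_simp [hun n]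
  · field_simp [hun n]
  · ring
  · field_simp
  · field_simp
  · ring

theorem A.induction_monomial (hq : ∀ n : ℕ, 0 < n → q ^ n ≠ 1) {p : A q c₀ → Prop} (zero : p 0)
    (add : ∀ a b, p a → p b → p (a + b)) (smul : ∀ (c : ℂ) a, p a → p (c • a))
    (he : ∀ i b n, p (k ^ i * (x ^ b * e ^ n))) (hf : ∀ i b n, p (k ^ i * (x ^ b * f ^ n)))
    (a : A q c₀) : p a := by
  obtain ⟨i, d, h⟩ := exists_x_pow_mul_mem hq a
  have := monoSpan_induction (p := fun y => p (k ^ i * y)) (by simpa using zero)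
    (fun a b ha hb => by rw [mul_add]; exact add _ _ ha hb)
    (fun c a ha => by rw [mul_smul_comm]; exact smul c _ ha) (fun b n _ => he i b n)
    (fun b n _ => hf i b n) h
  rwa [← mul_assoc, k_pow_mul_x_pow, one_mul] at this

/-- A sequence satisfying the recurrence for the values of a twisted trace on powers of `K`. -/
theorem exists_sequence (hq : ∀ n : ℕ, 0 < n → q ^ n ≠ 1) (c₀ : ℂ) :
    ∃ τ : ℤ → ℂ, τ 0 ≠ 0 ∧ ∀ l, (q : ℂ) ^ 2 * ((q : ℂ) ^ 2 * c₀ * τ (l - 1) -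
      casimirScale q * (q * τ l + (q : ℂ) ^ 3 * τ (l - 2))) = ((q : ℂ) ^ 2) ^ l *
        (c₀ * τ (l - 1) - casimirScale q * (q * τ l + (q : ℂ)⁻¹ * τ (l - 2))) := by
  have hα := casimirScale_ne_zero hq
  have hu := q_sq_ne_zero q
  have hq0 := q.ne_zero
  -- Setting (q² - q^(2m)) τ(m) = q^m σ(m) reduces the recurrence to c₀ σ(m) = α (σ(m+1) + σ(m-1)),
  -- with α = (q - q⁻¹)⁻². The negated index of S arranges σ(1) = S₋₁ = 0 and σ(0) = S₀ = 1.
  let σ : ℤ → ℂ := fun m => (Polynomial.Chebyshev.S ℂ (-m)).eval (c₀ / casimirScale q)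
  have hσ : ∀ m, c₀ * σ m = casimirScale q * (σ (m + 1) + σ (m - 1)) := by
    intro m
    have h := Polynomial.Chebyshev.S_add_two ℂ (-m - 1)
    rw [show -m - 1 + 2 = -(m - 1) by ring, show -m - 1 + 1 = -m by ring,
      show -m - 1 = -(m + 1) by ring] at h
    have h2 := congrArg (Polynomial.eval (c₀ / casimirScale q)) h
    simp only [Polynomial.eval_sub, Polynomial.eval_mul, Polynomial.eval_X] at h2
    change σ (m - 1) = c₀ / casimirScale q * σ m - σ (m + 1) at h2
    rw [h2]; field_simp; ring
  let τ : ℤ → ℂ := fun m => (q : ℂ) ^ m * σ m / ((q : ℂ) ^ 2 - ((q : ℂ) ^ 2) ^ m)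
  have hτ : ∀ m, ((q : ℂ) ^ 2 - ((q : ℂ) ^ 2) ^ m) * τ m = (q : ℂ) ^ m * σ m := by
    intro m
    -- The denominator vanishes exactly at m = 1. There σ vanishes as well, so division by zero
    -- returning 0 is consistent.
    rcases eq_or_ne m 1 with rfl | hm
    · simp [σ, Polynomial.Chebyshev.S_neg_one]
    · have h1 : (q : ℂ) ^ 2 - ((q : ℂ) ^ 2) ^ m ≠ 0 := by
        intro h
        apply sq_zpow_ne_one hq (n := m - 1) (by omega)
        rw [zpow_sub_one₀ hu, ← sub_eq_zero.1 h, mul_inv_cancel₀ hu]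
      exact mul_div_cancel₀ _ h1
  refine ⟨τ, ?_, fun l => ?_⟩
  · have h1 := hτ 0
    intro h
    rw [h] at h1
    simp [σ] at h1
  · have h1 := hτ l
    have h2 := hτ (l - 1)
    have h3 := hτ (l - 2)
    have h4 := hσ (l - 1)
    rw [sub_add_cancel, sub_sub, one_add_one_eq_two] at h4
    have e1 : (q : ℂ) ^ (l - 1) = (q : ℂ) ^ l / q := by rw [zpow_sub_one₀ hq0]; rfl
    have e2 : (q : ℂ) ^ (l - 2) = (q : ℂ) ^ l / q ^ 2 := by
      rw [zpow_sub₀ hq0]; norm_cast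
    have e3 : ((q : ℂ) ^ 2) ^ (l - 1) = ((q : ℂ) ^ 2) ^ l / q ^ 2 := by
      rw [zpow_sub_one₀ hu]; rfl
    have e4 : ((q : ℂ) ^ 2) ^ (l - 2) = ((q : ℂ) ^ 2) ^ l / (q ^ 2) ^ 2 := by
      rw [zpow_sub₀ hu]; norm_cast
    rw [e3, e1] at h2
    rw [e4, e2] at h3
    generalize ((q : ℂ) ^ 2) ^ l = U at *
    generalize (q : ℂ) ^ l = V at *
    generalize τ l = t₀ at *
    generalize τ (l - 1) = t₁ at *
    generalize τ (l - 2) = t₂ at *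
    generalize σ l = s₀ at *
    generalize σ (l - 1) = s₁ at *
    generalize σ (l - 2) = s₂ at *
    linear_combination (norm := (field_simp; ring)) c₀ * q ^ 2 * h2 - casimirScale q * q * h1 -
      casimirScale q * q ^ 3 * h3 + q * V * h4

theorem k_mul_x_pow (b : ℕ) : k * x ^ b = (x ^ b * k : A q c₀) := by
  have := mul_pow_of_mul_eq_smul (a := (k : A q c₀)) (b := x) (c := 1)
    (by rw [k_mul_x, x_mul_k, one_smul]) b
  rwa [one_pow, one_smul] at this

theorem e_mul_k_pow (i : ℕ) : e * k ^ i = (((q : ℂ) ^ 2)⁻¹) ^ i • (k ^ i * e : A q c₀) :=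
  mul_pow_of_mul_eq_smul e_mul_k i

theorem f_mul_k_pow (i : ℕ) : f * k ^ i = ((q : ℂ) ^ 2) ^ i • (k ^ i * f : A q c₀) :=
  mul_pow_of_mul_eq_smul f_mul_k i

theorem isTwistedTrace_of_generators {T : A q c₀ →ₗ[ℂ] ℂ} (hk : ∀ b, T (k * b) = T (b * k))
    (he : ∀ b, T (e * b) = ((q : ℂ) ^ 2)⁻¹ * T (b * e))
    (hf : ∀ b, T (f * b) = (q : ℂ) ^ 2 * T (b * f)) : IsTwistedTrace q c₀ (q ^ 2)⁻¹ T := by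
  have hx : ∀ b, T (x * b) = T (b * x) := fun b => by
    have := hk (x * b * x)
    rwa [← mul_assoc, ← mul_assoc, k_mul_x, one_mul, mul_assoc _ x k, x_mul_k, mul_one,
      eq_comm] at this
  have gk : g q c₀ (q ^ 2)⁻¹ k = k := by rw [k, g_of]; simp [gWeight]
  have gx : g q c₀ (q ^ 2)⁻¹ x = x := by rw [x, g_of]; simp [gWeight]
  have ge : g q c₀ (q ^ 2)⁻¹ e = ((q : ℂ) ^ 2)⁻¹ • e := by
    rw [e, map_mul (g q c₀ _), g_of, g_of]; simp [gWeight]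
  have gf : g q c₀ (q ^ 2)⁻¹ f = (q : ℂ) ^ 2 • f := by rw [f, g_of]; simp [gWeight]
  intro a
  induction a using A.induction with
  | one => intro b; simp
  | add a a' ha ha' => intro b; rw [add_mul, map_add, map_add, mul_add, map_add, ha, ha']
  | smul c a ha => intro b; rw [smul_mul_assoc, map_smul, map_smul, mul_smul_comm, map_smul, ha]
  | hk a ha => intro b; rw [mul_assoc, hk, mul_assoc, ha, map_mul (g q c₀ _), gk, mul_assoc]
  | hx a ha => intro b; rw [mul_assoc, hx, mul_assoc, ha, map_mul (g q c₀ _), gx, mul_assoc]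
  | he a ha =>
    intro b
    rw [mul_assoc, he, mul_assoc, ha, map_mul (g q c₀ _), ge, mul_assoc, smul_mul_assoc, mul_smul_comm,
      map_smul, smul_eq_mul]
  | hf a ha =>
    intro b
    rw [mul_assoc, hf, mul_assoc, ha, map_mul (g q c₀ _), gf, mul_assoc, smul_mul_assoc, mul_smul_comm,
      map_smul, smul_eq_mul]

theorem exists_functional (hq : ∀ n : ℕ, 0 < n → q ^ n ≠ 1) (c₀ : ℂ) (τ : ℤ → ℂ) :
    ∃ T : A q c₀ →ₗ[ℂ] ℂ, (∀ i b : ℕ, T (k ^ i * x ^ b) = τ (i - b)) ∧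
      (∀ i b n, T (k ^ i * (x ^ b * e ^ (n + 1))) = 0) ∧
      (∀ i b n, T (k ^ i * (x ^ b * f ^ (n + 1))) = 0) := by
  obtain ⟨φ, hk, hx, he, hf⟩ := exists_functionRep hq c₀
  -- The vector is supported on n = 0, and `T` reads off the value at n = j = 0. The action of e^n
  -- or f^n with n > 0 moves the support away from n = 0, so `T` sees only weight 0.
  let Ψ : ℤ → ℤ → ℂ := fun n j => if n = 0 then τ j else 0
  let T : A q c₀ →ₗ[ℂ] ℂ := LinearMap.proj (φ := fun _ : ℤ => ℂ) 0 ∘ₗ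
    LinearMap.proj (φ := fun _ : ℤ => ℤ → ℂ) 0 ∘ₗ LinearMap.applyₗ Ψ ∘ₗ φ.toLinearMap
  have hT : ∀ a, T a = φ a Ψ 0 0 := fun _ => rfl
  have hkp : ∀ (i : ℕ) Φ j, φ (k ^ i) Φ 0 j = Φ 0 (j + i) := by
    intro i
    induction i with
    | zero => intro Φ j; simp
    | succ i ih =>
      intro Φ j
      rw [pow_succ, map_mul, Module.End.mul_apply, ih, hk]
      simp [add_assoc]
  have hxp : ∀ (b : ℕ) Φ j, φ (x ^ b) Φ 0 j = Φ 0 (j - b) := by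
    intro i
    induction i with
    | zero => intro Φ j; simp
    | succ i ih =>
      intro Φ j
      rw [pow_succ, map_mul, Module.End.mul_apply, ih, hx]
      simp [sub_sub]
  have hep : ∀ (n : ℕ) m j, φ (e ^ n) Ψ m j = Ψ (m + n) j := by
    intro n
    induction n with
    | zero => intro m j; simp
    | succ n ih =>
      intro m j
      rw [pow_succ', map_mul, Module.End.mul_apply, he, ih]
      congr 1
      push_cast; ring
  have hfp : ∀ (n : ℕ) (m j : ℤ), m ≠ n → φ (f ^ n) Ψ m j = 0 := by
    intro n
    induction n with
    | zero => intro m j hm; rw [pow_zero, map_one]; exact if_neg (by simpa using hm)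
    | succ n ih =>
      intro m j hm
      have hm' : m - 1 ≠ n := fun h => hm (by push_cast; omega)
      rw [pow_succ', map_mul, Module.End.mul_apply, hf, ih _ _ hm', ih _ _ hm', ih _ _ hm']
      simp
  refine ⟨T, fun i b => ?_, fun i b n => ?_, fun i b n => ?_⟩
  · rw [hT, map_mul, Module.End.mul_apply, hkp, hxp]
    simp [Ψ]
  · rw [hT, map_mul, map_mul, Module.End.mul_apply, Module.End.mul_apply, hkp, hxp, hep]
    exact if_neg (by omega)
  · rw [hT, map_mul, map_mul, Module.End.mul_apply, Module.End.mul_apply, hkp, hxp,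
      hfp _ _ _ (by omega)]

-- Applied to the delta sequence at -j, `exists_functional` supplies a functional reading off the
-- coefficient of x^j.
open Polynomial in
theorem aeval_x_injective (hq : ∀ n : ℕ, 0 < n → q ^ n ≠ 1) (c₀ : ℂ) {R : ℂ[X]}
    (h : aeval (x : A q c₀) R = 0) : R = 0 := by
  ext j
  obtain ⟨T, hT, -, -⟩ := exists_functional hq c₀ fun m => if m = -j then 1 else 0
  have h1 := congrArg T h
  have h2 : ∀ i : ℕ, T (x ^ i) = if i = j then 1 else 0 := fun i => by
    have := hT 0 i
    simpa using this
  rw [aeval_eq_sum_range, map_sum, map_zero] at h1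
  simp only [map_smul, h2, smul_eq_mul, mul_ite, mul_one, mul_zero, Finset.sum_ite_eq',
    Finset.mem_range] at h1
  rw [coeff_zero]
  split_ifs at h1 with hj
  · exact h1
  · exact coeff_eq_zero_of_natDegree_lt (by omega)

theorem exists_isInvariantTrace (hq : ∀ n : ℕ, 0 < n → q ^ n ≠ 1) (c₀ : ℂ) :
    ∃ T, IsInvariantTrace q c₀ T := by
  have hu := q_sq_ne_zero q
  obtain ⟨τ, h0, hτ⟩ := exists_sequence hq c₀
  obtain ⟨T, h1, h2, h3⟩ := exists_functional hq c₀ τ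
  have h1' : ∀ b : ℕ, T (x ^ b) = τ (-b) := fun b => by simpa using h1 0 b
  refine ⟨T, isTwistedTrace_of_generators ?_ ?_ ?_, ?_⟩
  · intro b
    induction b using A.induction_monomial hq with
    | zero => simp
    | add a b ha hb => rw [mul_add, add_mul, map_add, map_add, ha, hb]
    | smul c a ha => rw [mul_smul_comm, smul_mul_assoc, map_smul, map_smul, ha]
    | he i b n =>
      have h4 : k ^ i * (x ^ b * e ^ n) * k =
          (((q : ℂ) ^ 2)⁻¹) ^ n • (k ^ (i + 1) * (x ^ b * e ^ n) : A q c₀) := by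
        rw [mul_assoc, mul_assoc, e_pow_mul_k, mul_smul_comm, mul_smul_comm, ← mul_assoc _ k,
          ← k_mul_x_pow, mul_assoc k, ← mul_assoc _ k, ← pow_succ]
      rw [h4, map_smul, ← mul_assoc, ← pow_succ']
      rcases n with _ | n
      · simp
      · rw [h2, smul_zero]
    | hf i b n =>
      have h4 : k ^ i * (x ^ b * f ^ n) * k =
          ((q : ℂ) ^ 2) ^ n • (k ^ (i + 1) * (x ^ b * f ^ n) : A q c₀) := by
        rw [mul_assoc, mul_assoc, f_pow_mul_k, mul_smul_comm, mul_smul_comm, ← mul_assoc _ k,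
          ← k_mul_x_pow, mul_assoc k, ← mul_assoc _ k, ← pow_succ]
      rw [h4, map_smul, ← mul_assoc, ← pow_succ']
      rcases n with _ | n
      · simp
      · rw [h3, smul_zero]
  · intro b
    induction b using A.induction_monomial hq with
    | zero => simp
    | add a b ha hb => rw [mul_add, add_mul, map_add, map_add, ha, hb]; ring
    | smul c a ha =>
      rw [mul_smul_comm, smul_mul_assoc, map_smul, map_smul, ha, smul_eq_mul, smul_eq_mul]; ring
    | he i b n =>
      rw [← mul_assoc, e_mul_k_pow, smul_mul_assoc, mul_assoc, e_mul_xe, mul_smul_comm, mul_assoc,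
        mul_assoc, ← pow_succ, map_smul, map_smul, h2]
      simp
    | hf i b n =>
      rcases n with _ | n
      · have h4 := h2 i b 0
        rw [zero_add, pow_one] at h4
        rw [pow_zero, mul_one, ← mul_assoc, e_mul_k_pow, smul_mul_assoc, mul_assoc, e_mul_x_pow,
          mul_smul_comm, mul_assoc, map_smul, map_smul, h4]
        simp
      · rw [← mul_assoc, e_mul_k_pow, smul_mul_assoc, mul_assoc, e_mul_xf hq, mul_assoc, mul_assoc,
          pow_succ f, mul_assoc (f ^ n), f_mul_e]
        have h5 : f ^ n * x ^ 2 = ((((q : ℂ) ^ 2)⁻¹) ^ n) ^ 2 • (x ^ 2 * f ^ n : A q c₀) :=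
          mul_pow_of_mul_eq_smul (f_pow_mul_x n) 2
        simp only [mul_sub, mul_add, mul_smul_comm, mul_one, f_pow_mul_x, h5, ← mul_assoc (x ^ b),
          ← pow_succ, ← pow_add, map_sub, map_add, map_smul, smul_eq_mul]
        rcases n with _ | n
        · have h6 := hτ (i - b)
          simp only [pow_zero, mul_one, h1, one_pow, one_mul]
          rw [show (i : ℤ) - (b + 1 : ℕ) = i - b - 1 by push_cast; ring,
            show (i : ℤ) - (b + 2 : ℕ) = i - b - 2 by push_cast; ring]
          rw [zpow_sub₀ hu, zpow_natCast, zpow_natCast] at h6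
          have hU := pow_ne_zero i hu
          have hB := pow_ne_zero b hu
          have hq0 := q.ne_zero
          simp only [inv_pow]
          generalize ((q : ℂ) ^ 2) ^ i = U at *
          generalize ((q : ℂ) ^ 2) ^ b = B at *
          linear_combination (norm := (field_simp; ring)) (U⁻¹ * B * ((q : ℂ) ^ 2)⁻¹) * h6
        · simp only [h3]
          simp
  · intro b
    induction b using A.induction_monomial hq with
    | zero => simp
    | add a b ha hb => rw [mul_add, add_mul, map_add, map_add, ha, hb]; ring
    | smul c a ha =>
      rw [mul_smul_comm, smul_mul_assoc, map_smul, map_smul, ha, smul_eq_mul, smul_eq_mul]; ring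
    | hf i b n =>
      rw [← mul_assoc, f_mul_k_pow, smul_mul_assoc, mul_assoc, f_mul_xf, mul_smul_comm, mul_assoc,
        mul_assoc, ← pow_succ, map_smul, map_smul, h3]
      simp
    | he i b n =>
      rcases n with _ | n
      · have h4 := h3 i b 0
        rw [zero_add, pow_one] at h4
        rw [pow_zero, mul_one, ← mul_assoc, f_mul_k_pow, smul_mul_assoc, mul_assoc, f_mul_x_pow,
          mul_smul_comm, mul_assoc, map_smul, map_smul, h4]
        simp
      · rw [← mul_assoc, f_mul_k_pow, smul_mul_assoc, mul_assoc, f_mul_xe, mul_assoc, mul_assoc,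
          pow_succ e, mul_assoc (e ^ n), e_mul_f hq]
        have h5 : e ^ n * x ^ 2 = (((q : ℂ) ^ 2) ^ n) ^ 2 • (x ^ 2 * e ^ n : A q c₀) :=
          mul_pow_of_mul_eq_smul (e_pow_mul_x n) 2
        simp only [mul_sub, mul_add, mul_smul_comm, mul_one, e_pow_mul_x, h5, ← mul_assoc (x ^ b),
          ← pow_succ, ← pow_add, map_sub, map_add, map_smul, smul_eq_mul]
        rcases n with _ | n
        · have h6 := hτ (i - b)
          simp only [pow_zero, mul_one, h1, one_pow, one_mul]
          rw [show (i : ℤ) - (b + 1 : ℕ) = i - b - 1 by push_cast; ring,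
            show (i : ℤ) - (b + 2 : ℕ) = i - b - 2 by push_cast; ring]
          rw [zpow_sub₀ hu, zpow_natCast, zpow_natCast] at h6
          linear_combination -h6
        · simp only [h2]
          simp
  · intro h
    apply h0
    have h4 := LinearMap.congr_fun h 1
    change T (1 : A q c₀) = 0 at h4
    have h5 := h1 0 0
    simp only [pow_zero, mul_one, h4] at h5
    simpa using h5.symm

/-! ## Nondegeneracy of the trace form -/

namespace IsTwistedTrace

variable {T : A q c₀ →ₗ[ℂ] ℂ} (hT : IsTwistedTrace q c₀ (q ^ 2)⁻¹ T)
include hT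

theorem e_pow_mul (m : ℕ) (a : A q c₀) :
    T (e ^ m * a) = (((q : ℂ) ^ 2)⁻¹) ^ m * T (a * e ^ m) := by
  induction m generalizing a with
  | zero => simp
  | succ m ih =>
    rw [pow_succ', mul_assoc, hT.e_mul, mul_assoc, ih, mul_assoc, ← mul_assoc, ← pow_succ']

/-- The automorphism g acts on each monomial by a nonzero scalar, so T(ay) and T(ya) differ by that
scalar for a monomial a. Left and right orthogonality to the span therefore agree. -/
theorem forall_mul_eq_zero_iff {d : ℕ} {y : A q c₀} :
    (∀ a ∈ monoSpan q c₀ d, T (a * y) = 0) ↔ ∀ a ∈ monoSpan q c₀ d, T (y * a) = 0 := by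
  have hu := q_sq_ne_zero q
  have key : ∀ a b : A q c₀, (∃ c : ℂ, c ≠ 0 ∧ ∀ z, T (b * z) = c * T (z * b)) → ∀ i : ℕ,
      a = x ^ i * b → (T (a * y) = 0 ↔ T (y * a) = 0) := by
    rintro a b ⟨c, hc, h⟩ i rfl
    rw [mul_assoc, hT.x_pow_mul, mul_assoc, h, mul_assoc, mul_eq_zero, or_iff_right hc]
  have hxe : ∀ b n, T (x ^ b * e ^ n * y) = 0 ↔ T (y * (x ^ b * e ^ n)) = 0 := fun b n =>
    key _ _ ⟨_, pow_ne_zero n (inv_ne_zero hu), hT.e_pow_mul n⟩ b rfl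
  have hxf : ∀ b n, T (x ^ b * f ^ n * y) = 0 ↔ T (y * (x ^ b * f ^ n)) = 0 := fun b n =>
    key _ _ ⟨_, pow_ne_zero n hu, hT.f_pow_mul n⟩ b rfl
  constructor
  · intro h a ha
    exact monoSpan_induction (p := fun a => T (y * a) = 0) (by simp)
      (fun a b ha hb => by rw [mul_add, map_add, ha, hb, add_zero])
      (fun c a ha => by rw [mul_smul_comm, map_smul, ha, smul_zero])
      (fun b n hb => (hxe b n).1 (h _ (xe_mem hb))) (fun b n hb => (hxf b n).1 (h _ (xf_mem hb))) ha
  · intro h a ha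
    exact monoSpan_induction (p := fun a => T (a * y) = 0) (by simp)
      (fun a b ha hb => by rw [add_mul, map_add, ha, hb, add_zero])
      (fun c a ha => by rw [smul_mul_assoc, map_smul, ha, smul_zero])
      (fun b n hb => (hxe b n).2 (h _ (xe_mem hb))) (fun b n hb => (hxf b n).2 (h _ (xf_mem hb))) ha

theorem forall_filt_mul_eq_zero_iff (hq : ∀ n : ℕ, 0 < n → q ^ n ≠ 1) {i : ℕ} {y : APlus q c₀} :
    (∀ a ∈ filt q c₀ i, restrictPlus q c₀ T (a * y) = 0) ↔
      ∀ a ∈ filt q c₀ i, restrictPlus q c₀ T (y * a) = 0 := by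
  have h1 : ∀ p : A q c₀ → Prop, (∀ a ∈ filt q c₀ i, p a) ↔ ∀ a ∈ monoSpan q c₀ (i / 2), p a :=
    fun p => ⟨fun h a ha => h ⟨a, mem_APlus_of_mem_monoSpan ha⟩ ((mem_filt_iff hq).2 ha),
      fun h a ha => h a ((mem_filt_iff hq).1 ha)⟩
  exact ((h1 fun a => T (a * y) = 0).trans hT.forall_mul_eq_zero_iff).trans
    (h1 fun a => T (y * a) = 0).symm

end IsTwistedTrace

theorem isNondegenerateOn_of_not_hasFiniteDimensionalRep (hq : ∀ n : ℕ, 0 < n → q ^ n ≠ 1)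
    {T : A q c₀ →ₗ[ℂ] ℂ} (hT : IsInvariantTrace q c₀ T)
    (hrep : ¬ HasFiniteDimensionalRep (A q c₀)) :
    IsNondegenerateOn (filt q c₀) (restrictPlus q c₀ T) := by
  have key : ∀ i, ∀ y ∈ filt q c₀ i, (∀ a ∈ filt q c₀ i, restrictPlus q c₀ T (y * a) = 0) →
      y = 0 := by
    intro i y hy h
    by_contra h0
    have hrad : (y : A q c₀) ∈ radical T (i / 2) := ⟨(mem_filt_iff hq).1 hy, fun b hb =>
      h ⟨b, mem_APlus_of_mem_monoSpan hb⟩ ((mem_filt_iff hq).2 hb)⟩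
    obtain ⟨m, hm, hmem⟩ := hT.1.exists_e_pow_mem_radical hq hrad fun h => h0 (Subtype.ext h)
    have h1 : T (e ^ m * f ^ m) = 0 := by
      refine hmem.2 _ ?_
      simpa using xf_mem (q := q) (c₀ := c₀) (b := 0) (n := m) (by omega)
    refine hrep (hasFiniteDimensionalRep_of_trace_eq_zero hq hT (m := m) ?_ h1)
    rintro rfl
    exact hT.one_ne_zero hq (by simpa using h1)
  refine fun i => ⟨fun y hy => ?_, fun y hy => ?_⟩
  · exact Subtype.ext (key i y y.2 fun a ha => hy ⟨a, ha⟩)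
  · exact Subtype.ext (key i y y.2 ((hT.1.forall_filt_mul_eq_zero_iff hq).1
      fun a ha => hy ⟨a, ha⟩))

theorem exists_mem_filt (hq : ∀ n : ℕ, 0 < n → q ^ n ≠ 1) (y : APlus q c₀) :
    ∃ i, y ∈ filt q c₀ i := by
  obtain ⟨d, hd⟩ := exists_mem_monoSpan hq y.2
  exact ⟨2 * d, (mem_filt_iff hq).2 (by simpa using hd)⟩

theorem ker_traceForm_eq_bot (hq : ∀ n : ℕ, 0 < n → q ^ n ≠ 1) {T : APlus q c₀ →ₗ[ℂ] ℂ}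
    (h : IsNondegenerateOn (filt q c₀) T) : LinearMap.ker (traceForm T) = ⊥ := by
  refine LinearMap.ker_eq_bot'.2 fun y hy => ?_
  obtain ⟨i, hi⟩ := exists_mem_filt hq y
  exact congrArg Subtype.val ((h i).1 ⟨y, hi⟩ fun a => LinearMap.congr_fun hy a)

theorem ker_traceForm_flip_eq_bot (hq : ∀ n : ℕ, 0 < n → q ^ n ≠ 1) {T : APlus q c₀ →ₗ[ℂ] ℂ}
    (h : IsNondegenerateOn (filt q c₀) T) : LinearMap.ker (traceForm T).flip = ⊥ := by
  refine LinearMap.ker_eq_bot'.2 fun y hy => ?_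
  obtain ⟨i, hi⟩ := exists_mem_filt hq y
  exact congrArg Subtype.val ((h i).2 ⟨y, hi⟩ fun a => LinearMap.congr_fun hy a)

/-! ## The trace of a finite-dimensional representation -/

section Representation

variable {V : Type*} [AddCommGroup V] [Module ℂ V]

/-- The functional `a ↦ tr(ρ(a K⁻¹))`. -/
def repTrace (ρ : A q c₀ →ₐ[ℂ] Module.End ℂ V) : A q c₀ →ₗ[ℂ] ℂ :=
  LinearMap.trace ℂ V ∘ₗ LinearMap.mulRight ℂ (ρ x) ∘ₗ ρ.toLinearMap

theorem repTrace_apply (ρ : A q c₀ →ₐ[ℂ] Module.End ℂ V) (a : A q c₀) : repTrace ρ a = LinearMap.trace ℂ V (ρ a * ρ x) := rfl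

/-- Conjugation by K⁻¹ sends E to q⁻²E and F to q²F, so it implements the twist. Inserting ρ(x)
turns the ordinary trace into a twisted one. -/
theorem isTwistedTrace_repTrace (ρ : A q c₀ →ₐ[ℂ] Module.End ℂ V) :
    IsTwistedTrace q c₀ (q ^ 2)⁻¹ (repTrace ρ) := by
  have h : ∀ a b c : A q c₀, ∀ z : ℂ, x * a = z • (a * x) →
      repTrace ρ (a * b) = z * repTrace ρ (b * a) := by
    intro a b c z hz
    rw [repTrace_apply, repTrace_apply, map_mul ρ, mul_assoc, LinearMap.trace_mul_comm, mul_assoc,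
      ← map_mul ρ x, hz, map_smul, mul_smul_comm, map_smul, smul_eq_mul, map_mul ρ, map_mul ρ,
      mul_assoc]
  refine isTwistedTrace_of_generators (fun b => ?_) (fun b => ?_) (fun b => ?_)
  · rw [h k b 1 1 (by rw [x_mul_k, k_mul_x, one_smul]), one_mul]
  · exact h e b 1 _ x_mul_e
  · exact h f b 1 _ x_mul_f

open Polynomial in
theorem exists_mem_kernel_of_rep (ρ : A q c₀ →ₐ[ℂ] Module.End ℂ V)
    (hq : ∀ n : ℕ, 0 < n → q ^ n ≠ 1) [FiniteDimensional ℂ V]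
    [Nontrivial V] {T : A q c₀ →ₗ[ℂ] ℂ} (hT : IsInvariantTrace q c₀ T) :
    ∃ y : APlus q c₀, y ≠ 0 ∧ (∀ b, restrictPlus q c₀ T (y * b) = 0) ∧
      ∀ b, restrictPlus q c₀ T (b * y) = 0 := by
  set χ := (ρ x).charpoly with hχ
  have hχx : ρ (aeval x χ) = 0 := by
    rw [← aeval_algHom_apply, hχ, LinearMap.aeval_self_charpoly]
  have hχ0 : χ.coeff 0 ≠ 0 := by
    intro h
    have h1 : LinearMap.det (ρ x) = 0 := by rw [LinearMap.det_eq_sign_charpoly_coeff, ← hχ, h, mul_zero]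
    have h2 : LinearMap.det (ρ x * ρ k) = 1 := by rw [← map_mul, x_mul_k, map_one, map_one]
    rw [map_mul, h1, zero_mul] at h2
    exact zero_ne_one h2
  obtain ⟨z, hz⟩ := hT.exists_smul hq (isTwistedTrace_repTrace ρ)
  have hz0 : z ≠ 0 := by
    rintro rfl
    rw [zero_smul] at hz
    -- The test element (χ(x) - χ(0))/x cancels the extra ρ(x) in the trace. By Cayley–Hamilton its
    -- value is -χ(0) dim V, which is nonzero.
    have h1 := LinearMap.congr_fun hz (aeval (xPlus q c₀) χ.divX)
    change repTrace ρ ((aeval (xPlus q c₀) χ.divX : APlus q c₀) : A q c₀) = 0 at h1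
    rw [aeval_xPlus, repTrace_apply, ← map_mul] at h1
    have h2 : aeval (x : A q c₀) χ.divX * x = aeval x χ - χ.coeff 0 • 1 := by
      conv_rhs => rw [← divX_mul_X_add χ]
      simp [Algebra.algebraMap_eq_smul_one]
    rw [h2, map_sub, hχx, map_smul, map_one, zero_sub, map_neg, map_smul, LinearMap.trace_one] at h1
    simp only [smul_eq_mul, neg_eq_zero, mul_eq_zero, hχ0, false_or, Nat.cast_eq_zero] at h1
    exact Module.finrank_pos.ne' h1
  have hT' : ∀ y, restrictPlus q c₀ T y = 0 ↔ repTrace ρ y = 0 := by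
    intro y
    have h1 := LinearMap.congr_fun hz y
    change repTrace ρ y = z * restrictPlus q c₀ T y at h1
    rw [h1, mul_eq_zero, or_iff_right hz0]
  have hy : ((aeval (xPlus q c₀) χ : APlus q c₀) : A q c₀) = aeval x χ := aeval_xPlus χ
  refine ⟨aeval (xPlus q c₀) χ, fun h => ?_, fun b => ?_, fun b => ?_⟩
  · rw [h] at hy
    have := aeval_x_injective hq c₀ hy.symm
    rw [this] at hχ0
    simp at hχ0
  · rw [hT', Subalgebra.coe_mul, hy, repTrace_apply, map_mul ρ, hχx, zero_mul, zero_mul, map_zero]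
  · rw [hT', Subalgebra.coe_mul, hy, repTrace_apply, map_mul ρ, hχx, mul_zero, zero_mul, map_zero]

end Representation

theorem not_hasFiniteDimensionalRep_of_ker (hq : ∀ n : ℕ, 0 < n → q ^ n ≠ 1)
    {T : A q c₀ →ₗ[ℂ] ℂ} (hT : IsInvariantTrace q c₀ T)
    (h : LinearMap.ker (traceForm (restrictPlus q c₀ T)) = ⊥) :
    ¬ HasFiniteDimensionalRep (A q c₀) := by
  rintro ⟨V, _, _, _, _, ⟨ρ⟩⟩
  obtain ⟨y, h0, h1, -⟩ := exists_mem_kernel_of_rep ρ hq hT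
  exact h0 (LinearMap.ker_eq_bot'.1 h y (LinearMap.ext h1))

theorem not_hasFiniteDimensionalRep_of_ker_flip (hq : ∀ n : ℕ, 0 < n → q ^ n ≠ 1)
    {T : A q c₀ →ₗ[ℂ] ℂ} (hT : IsInvariantTrace q c₀ T)
    (h : LinearMap.ker (traceForm (restrictPlus q c₀ T)).flip = ⊥) :
    ¬ HasFiniteDimensionalRep (A q c₀) := by
  rintro ⟨V, _, _, _, _, ⟨ρ⟩⟩
  obtain ⟨y, h0, -, h1⟩ := exists_mem_kernel_of_rep ρ hq hT
  exact h0 (LinearMap.ker_eq_bot'.1 h y (LinearMap.ext h1))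

theorem tfae_nondegenerate (hq : ∀ n : ℕ, 0 < n → q ^ n ≠ 1)
    {T : A q c₀ →ₗ[ℂ] ℂ} (hT : IsInvariantTrace q c₀ T) : List.TFAE [
      IsNondegenerateOn (filt q c₀) (restrictPlus q c₀ T),
      LinearMap.ker (traceForm (restrictPlus q c₀ T)) = ⊥,
      LinearMap.ker (traceForm (restrictPlus q c₀ T)).flip = ⊥,
      ¬ HasFiniteDimensionalRep (A q c₀)] := by
  tfae_have 1 → 2 := ker_traceForm_eq_bot hq
  tfae_have 1 → 3 := ker_traceForm_flip_eq_bot hq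
  tfae_have 2 → 4 := not_hasFiniteDimensionalRep_of_ker hq hT
  tfae_have 3 → 4 := not_hasFiniteDimensionalRep_of_ker_flip hq hT
  tfae_have 4 → 1 := isNondegenerateOn_of_not_hasFiniteDimensionalRep hq hT
  tfae_finish

/-! ## The values of the Casimir element on finite-dimensional representations -/

/-- The orbit of μ under powers of u is infinite, so it must leave a finite set. -/
theorem exists_last_pow {s : Set ℂ} (hs : s.Finite) {u : ℂ} (hu : u ≠ 0)
    (hu1 : ∀ n : ℕ, 0 < n → u ^ n ≠ 1) {μ : ℂ} (hμ : μ ∈ s) (hμ0 : μ ≠ 0) :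
    ∃ i : ℕ, u ^ i * μ ∈ s ∧ u ^ (i + 1) * μ ∉ s := by
  by_contra! h
  have hall : ∀ i : ℕ, u ^ i * μ ∈ s := fun i => by
    induction i with
    | zero => simpa using hμ
    | succ i ih => exact h i ih
  refine Set.infinite_of_injective_forall_mem (f := fun i : ℕ => u ^ i * μ) ?_ hall hs
  have key : ∀ i j : ℕ, i < j → u ^ i * μ ≠ u ^ j * μ := by
    intro i j hij he
    have h1 := mul_right_cancel₀ hμ0 he
    obtain ⟨d, rfl⟩ := Nat.exists_eq_add_of_lt hij
    rw [add_assoc, pow_add] at h1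
    exact hu1 (d + 1) (by omega) (mul_left_cancel₀ (pow_ne_zero i hu) (by rw [← h1, mul_one]))
  intro i j hij
  rcases lt_trichotomy i j with h | h | h
  · exact (key i j h hij).elim
  · exact h
  · exact (key j i h hij.symm).elim

/-- Starting from one eigenvalue of K, the K-string is followed up and down to its two ends, where
fe and ef respectively kill an eigenvector. The two resulting expressions a + a⁻¹ = b + b⁻¹ for
c₀/α, with a = q^(2n) b ≠ b, force ab = 1 and a² = q^(2n). Irreducibility is not needed, since the
ends may belong to different eigenvectors. -/
theorem casimir_of_hasFiniteDimensionalRep (hq : ∀ n : ℕ, 0 < n → q ^ n ≠ 1)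
    (h : HasFiniteDimensionalRep (A q c₀)) : ∃ n : ℕ, (c₀ / casimirScale q) ^ 2 =
      ((q : ℂ) ^ 2) ^ n + (((q : ℂ) ^ 2) ^ n)⁻¹ + 2 := by
  obtain ⟨V, _, _, _, _, ⟨ρ⟩⟩ := h
  have hα := casimirScale_ne_zero hq
  have hu := q_sq_ne_zero q
  have hq0 := q.ne_zero
  have hu1 : ∀ n : ℕ, 0 < n → ((q : ℂ) ^ 2) ^ n ≠ 1 := fun n hn => by
    rw [← pow_mul]; exact pow_ne_one hq (by omega)
  have hu1' : ∀ n : ℕ, 0 < n → (((q : ℂ) ^ 2)⁻¹) ^ n ≠ 1 := fun n hn => by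
    rw [inv_pow]; exact fun h => hu1 n hn (inv_eq_one.1 h)
  set s : Set ℂ := {μ | (ρ k).HasEigenvalue μ} with hs
  have hfin : s.Finite := Module.End.finite_hasEigenvalue (ρ k)
  obtain ⟨μ, hμ⟩ := Module.End.exists_eigenvalue (ρ k)
  have hne : ∀ μ ∈ s, μ ≠ 0 := by
    rintro _ hμ rfl
    obtain ⟨v, hv⟩ := hμ.exists_hasEigenvector
    apply hv.2
    have h1 := hv.apply_eq_smul
    rw [zero_smul] at h1
    have h2 : (ρ x * ρ k) v = v := by rw [← map_mul, x_mul_k, map_one]; rfl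
    rw [← h2, Module.End.mul_apply, h1, map_zero]
  have hxv : ∀ (μ : ℂ) (v : V), μ ≠ 0 → ρ k v = μ • v → ρ x v = μ⁻¹ • v := by
    intro μ v hμ hv
    have h2 : (ρ x * ρ k) v = v := by rw [← map_mul, x_mul_k, map_one]; rfl
    rw [Module.End.mul_apply, hv, map_smul] at h2
    exact (eq_inv_smul_iff₀ hμ).2 h2
  -- An element of weight factor c sends a μ-eigenvector of K into the cμ-eigenspace, which is zero
  -- at the end of a string.
  have hzero : ∀ (a : A q c₀) (c μ : ℂ) (v : V), k * a = c • (a * k) → c * μ ∉ s →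
      ρ k v = μ • v → ρ a v = 0 := by
    intro a c μ v ha hnot hv
    by_contra h0
    refine hnot (Module.End.hasEigenvalue_of_hasEigenvector (x := ρ a v)
      (Module.End.hasEigenvector_iff.2 ⟨Module.End.mem_eigenspace_iff.2 ?_, h0⟩))
    rw [← Module.End.mul_apply, ← map_mul, ha, map_smul, LinearMap.smul_apply, map_mul,
      Module.End.mul_apply, hv, map_smul, smul_smul]
  have top : ∀ μ ∈ s, (q : ℂ) ^ 2 * μ ∉ s →
      c₀ / casimirScale q = (q : ℂ) * μ + ((q : ℂ) * μ)⁻¹ := by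
    intro μ hμ hnot
    have hμ0 := hne μ hμ
    obtain ⟨v, hv⟩ := Module.End.HasEigenvalue.exists_hasEigenvector hμ
    have hkv := hv.apply_eq_smul
    have h1 : ρ (f * e) v = 0 := by
      rw [map_mul, Module.End.mul_apply, hzero e _ μ v k_mul_e hnot hkv, map_zero]
    rw [f_mul_e] at h1
    simp only [map_sub, map_add, map_smul, map_one, map_pow, pow_two (ρ x), LinearMap.sub_apply,
      LinearMap.add_apply, LinearMap.smul_apply, Module.End.mul_apply, Module.End.one_apply,
      hxv μ v hμ0 hkv, smul_smul, ← add_smul, ← sub_smul] at h1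
    have h2 := (smul_eq_zero.1 h1).resolve_right hv.2
    field_simp at h2 ⊢
    linear_combination h2
  have bot : ∀ μ ∈ s, ((q : ℂ) ^ 2)⁻¹ * μ ∉ s →
      c₀ / casimirScale q = (q : ℂ)⁻¹ * μ + ((q : ℂ)⁻¹ * μ)⁻¹ := by
    intro μ hμ hnot
    have hμ0 := hne μ hμ
    obtain ⟨v, hv⟩ := Module.End.HasEigenvalue.exists_hasEigenvector hμ
    have hkv := hv.apply_eq_smul
    have h1 : ρ (e * f) v = 0 := by
      rw [map_mul, Module.End.mul_apply, hzero f _ μ v k_mul_f hnot hkv, map_zero]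
    rw [e_mul_f hq] at h1
    simp only [map_sub, map_add, map_smul, map_one, map_pow, pow_two (ρ x), LinearMap.sub_apply,
      LinearMap.add_apply, LinearMap.smul_apply, Module.End.mul_apply, Module.End.one_apply,
      hxv μ v hμ0 hkv, smul_smul, ← add_smul, ← sub_smul] at h1
    have h2 := (smul_eq_zero.1 h1).resolve_right hv.2
    field_simp at h2 ⊢
    refine mul_left_cancel₀ hq0 ?_
    linear_combination h2
  obtain ⟨i, hi, hi'⟩ := exists_last_pow hfin hu hu1 hμ (hne μ hμ)
  obtain ⟨j, hj, hj'⟩ := exists_last_pow hfin (inv_ne_zero hu) hu1' hμ (hne μ hμ)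
  have h1 := top _ hi (by rwa [← mul_assoc, ← pow_succ'])
  have h2 := bot _ hj (by rwa [← mul_assoc, ← pow_succ'])
  refine ⟨i + j + 1, ?_⟩
  have ha0 : (q : ℂ) * (((q : ℂ) ^ 2) ^ i * μ) ≠ 0 := mul_ne_zero hq0 (hne _ hi)
  have hb0 : (q : ℂ)⁻¹ * ((((q : ℂ) ^ 2)⁻¹) ^ j * μ) ≠ 0 := mul_ne_zero (inv_ne_zero hq0) (hne _ hj)
  have hab : (q : ℂ) * (((q : ℂ) ^ 2) ^ i * μ) =
      ((q : ℂ) ^ 2) ^ (i + j + 1) * ((q : ℂ)⁻¹ * ((((q : ℂ) ^ 2)⁻¹) ^ j * μ)) := by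
    rw [inv_pow, pow_succ _ (i + j), pow_add]
    have := pow_ne_zero j hu
    generalize ((q : ℂ) ^ 2) ^ i = U at *
    generalize ((q : ℂ) ^ 2) ^ j = W at *
    field_simp
  have hU := hu1 (i + j + 1) (by omega)
  have hU0 := pow_ne_zero (i + j + 1) hu
  generalize ((q : ℂ) ^ 2) ^ (i + j + 1) = U at *
  generalize (q : ℂ) * (((q : ℂ) ^ 2) ^ i * μ) = a at *
  generalize (q : ℂ)⁻¹ * ((((q : ℂ) ^ 2)⁻¹) ^ j * μ) = b at *
  have h3 : a * b = 1 := by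
    have h4 := h1.symm.trans h2
    have h5 : a ≠ b := by
      intro h
      rw [h] at hab
      exact hU (mul_right_cancel₀ hb0 (by rw [← hab, one_mul]))
    field_simp at h4
    have h6 : (a - b) * (a * b - 1) = 0 := by linear_combination h4
    exact sub_eq_zero.1 ((mul_eq_zero.1 h6).resolve_left (sub_ne_zero.2 h5))
  have h7 : a ^ 2 = U := by
    rw [pow_two]; nth_rewrite 2 [hab]; rw [mul_left_comm, h3, mul_one]
  rw [h1, ← h7]
  field_simp
  ring

theorem countable_hasFiniteDimensionalRep (hq : ∀ n : ℕ, 0 < n → q ^ n ≠ 1) :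
    {c₀ : ℂ | HasFiniteDimensionalRep (A q c₀)}.Countable := by
  have hα := casimirScale_ne_zero hq
  refine Set.Countable.mono (s₂ := ⋃ n : ℕ, {c₀ : ℂ | (c₀ / casimirScale q) ^ 2 =
      ((q : ℂ) ^ 2) ^ n + (((q : ℂ) ^ 2) ^ n)⁻¹ + 2}) ?_ (Set.countable_iUnion fun n => ?_)
  · intro c₀ h
    exact Set.mem_iUnion.2 (casimir_of_hasFiniteDimensionalRep hq h)
  · refine Set.Finite.countable ?_
    generalize ((q : ℂ) ^ 2) ^ n + (((q : ℂ) ^ 2) ^ n)⁻¹ + 2 = a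
    obtain ⟨b, hb⟩ := IsAlgClosed.exists_pow_nat_eq a (n := 2) (by norm_num)
    refine Set.Finite.subset (Set.toFinite {casimirScale q * b, -(casimirScale q * b)}) ?_
    intro c hc
    have hc' : (c / casimirScale q) ^ 2 = a := hc
    rw [← hb, sq_eq_sq_iff_eq_or_eq_neg] at hc'
    rcases hc' with h | h
    · left; rw [← h]; field_simp
    · right
      rw [Set.mem_singleton_iff, ← mul_neg, ← h]; field_simp

end QSl2

/-! ## Short star-products from nondegenerate traces -/

section ShortStar

variable {R : Type*} [Ring R] [Algebra ℂ R]

/-- Orthogonal projection to W: nondegeneracy on a finite-dimensional W identifies W with its dual.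
-/
theorem exists_mem_forall_trace_eq {T : R →ₗ[ℂ] ℂ} (W : Submodule ℂ R) [FiniteDimensional ℂ W]
    (h : ∀ y ∈ W, (∀ b ∈ W, T (b * y) = 0) → y = 0) (y : R) :
    ∃ z ∈ W, ∀ b ∈ W, T (b * y) = T (b * z) := by
  let B : W →ₗ[ℂ] Module.Dual ℂ W := ((traceForm T).domRestrict₁₂ W W).flip
  have hB : Function.Injective B := by
    rw [← LinearMap.ker_eq_bot, LinearMap.ker_eq_bot']
    intro z hz
    exact Subtype.ext (h z z.2 fun b hb => LinearMap.congr_fun hz ⟨b, hb⟩)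
  have hB' : Function.Surjective B :=
    (LinearMap.injective_iff_surjective_of_finrank_eq_finrank
      (Subspace.dual_finrank_eq (K := ℂ) (V := W)).symm).1 hB
  obtain ⟨z, hz⟩ := hB' ((traceForm T).flip y ∘ₗ W.subtype)
  exact ⟨z, z.2, fun b hb => (LinearMap.congr_fun hz ⟨b, hb⟩).symm⟩

/-- The hypotheses on a filtered algebra with a functional under which the orthogonal lift exists
and gives a short star-product. -/
structure IsOrthogonalizable (F : ℕ → Submodule ℂ R) (T : R →ₗ[ℂ] ℂ) : Prop where
  mono : Monotone F
  exists_mem : ∀ y, ∃ k, y ∈ F k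
  finite : ∀ k, FiniteDimensional ℂ (F k)
  odd : ∀ k, F (2 * k + 1) = F (2 * k)
  orth_iff : ∀ k y, (∀ b ∈ F k, T (b * y) = 0) ↔ ∀ b ∈ F k, T (y * b) = 0
  nondegenerate : ∀ k, ∀ y ∈ F k, (∀ b ∈ F k, T (b * y) = 0) → y = 0

namespace IsOrthogonalizable

open Filt

variable {F : ℕ → Submodule ℂ R} {T : R →ₗ[ℂ] ℂ} (h : IsOrthogonalizable F T)

/-- The orthogonal complement of `F_{≤ k-1}` in `F_{≤ k}`. -/
def orthComp (F : ℕ → Submodule ℂ R) (T : R →ₗ[ℂ] ℂ) (k : ℕ) : Submodule ℂ R where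
  carrier := {y | y ∈ F k ∧ ∀ b ∈ lower F k, T (b * y) = 0}
  add_mem' := fun h1 h2 => ⟨add_mem h1.1 h2.1, fun b hb => by
    rw [mul_add, map_add, h1.2 b hb, h2.2 b hb, add_zero]⟩
  zero_mem' := ⟨zero_mem _, by simp⟩
  smul_mem' := fun c _ h1 => ⟨Submodule.smul_mem _ c h1.1, fun b hb => by
    rw [mul_smul_comm, map_smul, h1.2 b hb, smul_zero]⟩

/-- The projection of the orthogonal complement to the associated graded space. -/
def proj (F : ℕ → Submodule ℂ R) (T : R →ₗ[ℂ] ℂ) (k : ℕ) : orthComp F T k →ₗ[ℂ] Gr F k :=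
  Submodule.mkQ _ ∘ₗ Submodule.inclusion fun _ hy => hy.1

include h

theorem lower_le (k : ℕ) : lower F k ≤ F k := by
  cases k with
  | zero => exact bot_le
  | succ k => exact h.mono k.le_succ

theorem le_lower {j k : ℕ} (hjk : j < k) : F j ≤ lower F k := by
  cases k with
  | zero => omega
  | succ k => exact h.mono (by omega)

theorem eq_zero_of_mem_lower {k : ℕ} {y : R} (hy : y ∈ lower F k)
    (hT : ∀ b ∈ lower F k, T (b * y) = 0) : y = 0 := by
  cases k with
  | zero => exact (Submodule.mem_bot ℂ).1 hy
  | succ k => exact h.nondegenerate k y hy hT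

theorem finite_lower (k : ℕ) : FiniteDimensional ℂ (lower F k) := by
  cases k with
  | zero => exact inferInstanceAs (FiniteDimensional ℂ (⊥ : Submodule ℂ R))
  | succ k => exact h.finite k

theorem orth_lower_iff (k : ℕ) (y : R) :
    (∀ b ∈ lower F k, T (b * y) = 0) ↔ ∀ b ∈ lower F k, T (y * b) = 0 := by
  cases k with
  | zero =>
    have : ∀ b ∈ lower F 0, b = 0 := fun b hb => (Submodule.mem_bot ℂ).1 hb
    constructor <;> intro _ b hb <;> rw [this b hb] <;> simp
  | succ k => exact h.orth_iff k y

/-- Nondegeneracy on the lower step gives both halves: an element of the lower step orthogonal to it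
is zero, and any lift can be corrected by its projection to the lower step. -/
theorem proj_bijective (k : ℕ) : Function.Bijective (proj F T k) := by
  constructor
  · rw [← LinearMap.ker_eq_bot, LinearMap.ker_eq_bot']
    rintro ⟨y, hy⟩ hy0
    have : y ∈ lower F k :=
      (Submodule.Quotient.mk_eq_zero ((lower F k).comap (F k).subtype)).1 hy0
    exact Subtype.ext (h.eq_zero_of_mem_lower this hy.2)
  · intro a
    obtain ⟨y, hy, rfl⟩ := exists_cls a
    have := h.finite_lower k
    obtain ⟨z, hz, hT⟩ := exists_mem_forall_trace_eq (T := T) (lower F k)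
      (fun y hy => h.eq_zero_of_mem_lower hy) y
    refine ⟨⟨y - z, sub_mem hy (h.lower_le k hz), fun b hb => by
      rw [mul_sub, map_sub, hT b hb, sub_self]⟩, ?_⟩
    refine (Submodule.Quotient.eq _).2 ?_
    change y - z - y ∈ lower F k
    rw [sub_sub_cancel_left]
    exact neg_mem hz

/-- The lift of a homogeneous element to the orthogonal complement of lower degrees. -/
def lift (k : ℕ) : Gr F k →ₗ[ℂ] R :=
  (orthComp F T k).subtype ∘ₗ (LinearEquiv.ofBijective _ (h.proj_bijective k)).symm.toLinearMap

theorem lift_mem_orthComp {k : ℕ} (a : Gr F k) : h.lift k a ∈ orthComp F T k :=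
  ((LinearEquiv.ofBijective _ (h.proj_bijective k)).symm a).2

theorem lift_mem {k : ℕ} (a : Gr F k) : h.lift k a ∈ F k := (h.lift_mem_orthComp a).1

theorem cls_lift {k : ℕ} (a : Gr F k) : cls F k (h.lift k a) (h.lift_mem a) = a :=
  (LinearEquiv.ofBijective _ (h.proj_bijective k)).apply_symm_apply a

theorem trace_mul_lift {k : ℕ} (a : Gr F k) {b : R} (hb : b ∈ lower F k) :
    T (b * h.lift k a) = 0 := (h.lift_mem_orthComp a).2 b hb

theorem trace_lift_mul {k : ℕ} (a : Gr F k) {b : R} (hb : b ∈ lower F k) :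
    T (h.lift k a * b) = 0 :=
  (h.orth_lower_iff k _).1 (fun _ hb => h.trace_mul_lift a hb) b hb

theorem eq_lift {k : ℕ} {a : Gr F k} {y : R} (hy : y ∈ orthComp F T k)
    (ha : cls F k y hy.1 = a) : y = h.lift k a := by
  have : (⟨y, hy⟩ : orthComp F T k) = (LinearEquiv.ofBijective _ (h.proj_bijective k)).symm a :=
    (LinearEquiv.eq_symm_apply _).2 ha
  exact congrArg Subtype.val this

theorem eq_zero_of_lift {k : ℕ} {a : Gr F k} (ha : h.lift k a = 0) : a = 0 := by
  rw [← h.cls_lift a]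
  exact (Submodule.Quotient.mk_eq_zero _).2 (by
    change h.lift k a ∈ lower F k
    rw [ha]; exact zero_mem _)

theorem sub_lift_mem {k : ℕ} {y : R} (hy : y ∈ F k) : y - h.lift k (cls F k y hy) ∈ lower F k :=
  (Submodule.Quotient.eq ((lower F k).comap (F k).subtype)).1 (h.cls_lift (cls F k y hy)).symm

theorem subsingleton_odd (k : ℕ) (a : Gr F (2 * k + 1)) : a = 0 := by
  obtain ⟨y, hy, rfl⟩ := exists_cls a
  refine (Submodule.Quotient.mk_eq_zero _).2 ?_
  change y ∈ F (2 * k)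
  rwa [← h.odd]

/-- The orthogonal lift as a linear map. -/
def totalLift : (⨁ k, Gr F k) →ₗ[ℂ] R := DirectSum.toModule ℂ ℕ R h.lift

theorem totalLift_of {k : ℕ} (a : Gr F k) :
    h.totalLift (DirectSum.of (Gr F) k a) = h.lift k a :=
  DirectSum.toModule_lof (M := Gr F) ℂ k a

open Classical in
theorem totalLift_eq_sum (x : ⨁ k, Gr F k) :
    h.totalLift x = ∑ k ∈ DFinsupp.support x, h.lift k (x k) := by
  conv_lhs => rw [← DirectSum.sum_support_of x]
  rw [map_sum]
  exact Finset.sum_congr rfl fun k _ => h.totalLift_of _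

/-- The components are triangular for the form: against b in step n, those above n pair to zero and
those below vanish by induction. So the n-th lift is orthogonal to step n. -/
theorem apply_eq_zero_of_orth {x : ⨁ k, Gr F k} {j : ℕ}
    (hx : ∀ b ∈ F j, T (b * h.totalLift x) = 0) : ∀ n ≤ j, x n = 0 := by
  classical
  intro n
  induction n using Nat.strong_induction_on with
  | _ n ih =>
    intro hn
    refine h.eq_zero_of_lift (h.nondegenerate n _ (h.lift_mem _) fun b hb => ?_)
    have h1 := hx b (h.mono hn hb)
    rw [totalLift_eq_sum, Finset.mul_sum, map_sum, Finset.sum_eq_single n] at h1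
    · exact h1
    · intro m _ hmn
      rcases lt_or_gt_of_ne hmn with hm | hm
      · rw [ih m hm (by omega), map_zero, mul_zero, map_zero]
      · exact h.trace_mul_lift _ (h.le_lower hm hb)
    · intro hn'
      rw [DFinsupp.notMem_support_iff.1 hn', map_zero, mul_zero, map_zero]

theorem totalLift_injective : Function.Injective h.totalLift := by
  intro x y hxy
  have h0 : h.totalLift (x + (-1 : ℂ) • y) = 0 := by
    rw [map_add, map_smul, hxy, neg_one_smul, add_neg_cancel]
  refine DFinsupp.ext fun n => ?_
  have h1 : x n + (-1 : ℂ) • y n = 0 :=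
    h.apply_eq_zero_of_orth (j := n) (fun b _ => by rw [h0, mul_zero, map_zero]) n le_rfl
  rwa [neg_one_smul, ← sub_eq_add_neg, sub_eq_zero] at h1

theorem exists_totalLift_eq {k : ℕ} {y : R} (hy : y ∈ F k) :
    ∃ x, h.totalLift x = y ∧ (∀ n, k < n → x n = 0) ∧ x k = cls F k y hy := by
  induction k generalizing y with
  | zero =>
    refine ⟨DirectSum.of (Gr F) 0 (cls F 0 y hy), ?_, fun n hn => ?_, ?_⟩
    · rw [totalLift_of]
      exact (sub_eq_zero.1 ((Submodule.mem_bot ℂ).1 (h.sub_lift_mem hy))).symm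
    · exact DirectSum.of_eq_of_ne _ _ _ (by omega)
    · exact DirectSum.of_eq_same _ _
  | succ k ih =>
    obtain ⟨x, hx, hx0, -⟩ := ih (h.sub_lift_mem hy)
    refine ⟨DirectSum.of (Gr F) (k + 1) (cls F (k + 1) y hy) + x, ?_, fun n hn => ?_, ?_⟩
    · rw [map_add, totalLift_of, hx, add_sub_cancel]
    · rw [DirectSum.add_apply, DirectSum.of_eq_of_ne _ _ _ (by omega), hx0 n (by omega), add_zero]
    · rw [DirectSum.add_apply, DirectSum.of_eq_same, hx0 _ (by omega), add_zero]

theorem totalLift_surjective : Function.Surjective h.totalLift := fun y => by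
  obtain ⟨k, hk⟩ := h.exists_mem y
  obtain ⟨x, hx, -⟩ := h.exists_totalLift_eq hk
  exact ⟨x, hx⟩

/-- The orthogonal lift as a linear isomorphism. -/
def liftEquiv : (⨁ k, Gr F k) ≃ₗ[ℂ] R :=
  LinearEquiv.ofBijective h.totalLift ⟨h.totalLift_injective, h.totalLift_surjective⟩

theorem liftEquiv_of {k : ℕ} (a : Gr F k) :
    h.liftEquiv (DirectSum.of (Gr F) k a) = h.lift k a := h.totalLift_of a

theorem isOrthogonalLift : IsOrthogonalLift F T h.liftEquiv := by
  intro k a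
  rw [liftEquiv_of]
  exact ⟨⟨h.lift_mem a, h.cls_lift a⟩, fun b hb => ⟨h.trace_mul_lift a hb, h.trace_lift_mul a hb⟩⟩

theorem eq_liftEquiv {ψ : (⨁ k, Gr F k) ≃ₗ[ℂ] R} (hψ : IsOrthogonalLift F T ψ) :
    ψ = h.liftEquiv := by
  refine LinearEquiv.toLinearMap_injective (DirectSum.linearMap_ext (R := ℂ) fun k => ?_)
  refine LinearMap.ext fun a => ?_
  obtain ⟨⟨h1, h2⟩, h3⟩ := hψ k a
  change ψ (DirectSum.of (Gr F) k a) = h.liftEquiv (DirectSum.of (Gr F) k a)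
  rw [liftEquiv_of]
  exact h.eq_lift ⟨h1, fun b hb => (h3 b hb).1⟩ h2

theorem symm_apply_of_mem {k : ℕ} {y : R} (hy : y ∈ F k) :
    (∀ n, k < n → h.liftEquiv.symm y n = 0) ∧ h.liftEquiv.symm y k = cls F k y hy := by
  obtain ⟨x, hx, h1, h2⟩ := h.exists_totalLift_eq hy
  have : h.liftEquiv.symm y = x := (LinearEquiv.symm_apply_eq _).2 hx.symm
  rw [this]
  exact ⟨h1, h2⟩

theorem symm_apply_of_orth {y : R} {j : ℕ} (hy : ∀ b ∈ F j, T (b * y) = 0) {n : ℕ} (hn : n ≤ j) :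
    h.liftEquiv.symm y n = 0 := by
  refine h.apply_eq_zero_of_orth (j := j) ?_ n hn
  have : h.totalLift (h.liftEquiv.symm y) = y := h.liftEquiv.apply_symm_apply y
  rwa [this]

theorem star_of {k m : ℕ} (a : Gr F k) (b : Gr F m) :
    transportedProduct h.liftEquiv (DirectSum.of (Gr F) k a) (DirectSum.of (Gr F) m b) =
      h.liftEquiv.symm (h.lift k a * h.lift m b) := by
  rw [← liftEquiv_of, ← liftEquiv_of]; rfl

/-! ### Shortness and nondegeneracy of the transported product -/

variable [SetLike.GradedMonoid F]

theorem trace_liftEquiv (x : ⨁ k, Gr F k) :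
    T (h.liftEquiv x) = T (h.liftEquiv (DirectSum.of (Gr F) 0 (x 0))) := by
  induction x using DirectSum.induction_on with
  | zero => simp
  | of k a =>
    rcases eq_or_ne k 0 with rfl | hk
    · rw [DirectSum.of_eq_same]
    · rw [DirectSum.of_eq_of_ne _ _ _ hk.symm, map_zero, map_zero, map_zero, liftEquiv_of]
      have := h.trace_mul_lift a (h.le_lower (Nat.pos_of_ne_zero hk) SetLike.GradedOne.one_mem)
      rwa [one_mul] at this
  | add x y hx hy =>
    rw [map_add, map_add, hx, hy, DirectSum.add_apply, map_add, map_add, map_add]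

theorem isShortStarProduct : IsShortStarProduct (Gr F) (transportedProduct h.liftEquiv) where
  assoc x y z := by
    have hs : ∀ x y, transportedProduct h.liftEquiv x y =
      h.liftEquiv.symm (h.liftEquiv x * h.liftEquiv y) := fun _ _ => rfl
    simp only [hs, LinearEquiv.apply_symm_apply, mul_assoc]
  leading k m a b := by
    rw [star_of, (h.symm_apply_of_mem (SetLike.mul_mem_graded (h.lift_mem a) (h.lift_mem b))).2]
    conv_rhs => rw [← h.cls_lift a, ← h.cls_lift b]
    rfl
  short k m a b n hn := by
    rw [star_of] at hn
    have hmul := SetLike.mul_mem_graded (h.lift_mem a) (h.lift_mem b)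
    have h1 : n ≤ k + m := by
      by_contra h1
      exact hn ((h.symm_apply_of_mem hmul).1 n (by omega))
    -- If n + m < k, then φ(b)c lies strictly below degree k for c in step n, so it is orthogonal to
    -- φ(a). With the symmetric bound this gives |k - m| ≤ n ≤ k + m.
    have h2 : k ≤ n + m := by
      by_contra h2
      refine hn (h.symm_apply_of_orth (j := n) ((h.orth_iff n _).2 fun c hc => ?_) le_rfl)
      rw [mul_assoc]
      exact h.trace_lift_mul a (h.le_lower (by omega)
        (SetLike.mul_mem_graded (h.lift_mem b) hc))
    have h3 : m ≤ n + k := by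
      by_contra h3
      refine hn (h.symm_apply_of_orth (j := n) (fun c hc => ?_) le_rfl)
      rw [← mul_assoc]
      exact h.trace_mul_lift b (h.le_lower (by omega)
        (SetLike.mul_mem_graded hc (h.lift_mem a)))
    -- Odd graded pieces vanish, so n, k and m are all even and i = (k + m - n)/2 is an integer.
    have hn2 : n % 2 = 0 := by
      by_contra h4
      obtain ⟨n, rfl⟩ : ∃ j, n = 2 * j + 1 := ⟨n / 2, by omega⟩
      exact hn (h.subsingleton_odd _ _)
    have hk2 : k % 2 = 0 := by
      by_contra h4
      obtain ⟨k, rfl⟩ : ∃ j, k = 2 * j + 1 := ⟨k / 2, by omega⟩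
      rw [h.subsingleton_odd _ a, map_zero, zero_mul, map_zero] at hn
      exact hn rfl
    have hm2 : m % 2 = 0 := by
      by_contra h4
      obtain ⟨m, rfl⟩ : ∃ j, m = 2 * j + 1 := ⟨m / 2, by omega⟩
      rw [h.subsingleton_odd _ b, map_zero, mul_zero, map_zero] at hn
      exact hn rfl
    exact ⟨(k + m - n) / 2, by omega, by omega⟩

theorem trace_lift_mul_lift {k : ℕ} {a b : Gr F k}
    (hab : transportedProduct h.liftEquiv (DirectSum.of (Gr F) k a) (DirectSum.of (Gr F) k b) 0 = 0) :
    T (h.lift k a * h.lift k b) = 0 := by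
  have h1 := h.trace_liftEquiv
    (transportedProduct h.liftEquiv (DirectSum.of (Gr F) k a) (DirectSum.of (Gr F) k b))
  rwa [hab, map_zero, map_zero, map_zero, star_of, LinearEquiv.apply_symm_apply] at h1

/-- An element of step k is the lift of its class plus something lower. The lower part is orthogonal
to lifts, and the lift part is controlled by the constant term because T ∘ φ sees only degree zero.
-/
theorem isNondegenerateStar : IsNondegenerateStar (Gr F) (transportedProduct h.liftEquiv) := by
  refine fun k => ⟨fun a ha => ?_, fun b hb => ?_⟩
  · refine h.eq_zero_of_lift (h.nondegenerate k _ (h.lift_mem a)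
      ((h.orth_iff k _).2 fun c hc => ?_))
    rw [← sub_add_cancel c (h.lift k (cls F k c hc)), mul_add, map_add,
      h.trace_lift_mul a (h.sub_lift_mem hc), h.trace_lift_mul_lift (ha _), add_zero]
  · refine h.eq_zero_of_lift (h.nondegenerate k _ (h.lift_mem b) fun c hc => ?_)
    rw [← sub_add_cancel c (h.lift k (cls F k c hc)), add_mul, map_add,
      h.trace_mul_lift b (h.sub_lift_mem hc), h.trace_lift_mul_lift (hb _), add_zero]

theorem givesNondegenerateShortStar : GivesNondegenerateShortStar F T :=
  ⟨h.liftEquiv, h.isOrthogonalLift, fun _ hψ => h.eq_liftEquiv hψ, h.isShortStarProduct,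
    h.isNondegenerateStar, h.trace_liftEquiv⟩

end IsOrthogonalizable

end ShortStar

/-! ### The filtration of 𝒜₊ is orthogonalizable -/

namespace QSl2

variable {q : ℂˣ} {c₀ : ℂ}

theorem isOrthogonalizable (hq : ∀ n : ℕ, 0 < n → q ^ n ≠ 1) {T : A q c₀ →ₗ[ℂ] ℂ}
    (hT : IsInvariantTrace q c₀ T) (h : IsNondegenerateOn (filt q c₀) (restrictPlus q c₀ T)) :
    IsOrthogonalizable (filt q c₀) (restrictPlus q c₀ T) where
  mono := fun i j hij y hy =>
    (mem_filt_iff hq).2 (monoSpan_mono (Nat.div_le_div_right hij) ((mem_filt_iff hq).1 hy))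
  exists_mem := exists_mem_filt hq
  finite := finiteDimensional_filt hq
  odd := fun k => by
    ext y
    rw [mem_filt_iff hq, mem_filt_iff hq, show (2 * k + 1) / 2 = 2 * k / 2 by omega]
  orth_iff := fun _ _ => hT.1.forall_filt_mul_eq_zero_iff hq
  nondegenerate := fun k y hy hy0 =>
    congrArg Subtype.val ((h k).2 ⟨y, hy⟩ fun a => hy0 a a.2)

end QSl2

end

theorem mainTheorem9 (q : ℂˣ) (hq : ∀ n : ℕ, 0 < n → q ^ n ≠ 1) :
    (∀ c₀ : ℂ,
      (∃ T, QSl2.IsInvariantTrace q c₀ T) ∧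
      ∀ T, QSl2.IsInvariantTrace q c₀ T →
        QSl2.IsAdInvariant q c₀ T ∧
        (∀ T', QSl2.IsTwistedTrace q c₀ (q ^ 2)⁻¹ T' →
          ∃ z : ℂ, QSl2.restrictPlus q c₀ T' = z • QSl2.restrictPlus q c₀ T) ∧
        List.TFAE [
          IsNondegenerateOn (QSl2.filt q c₀) (QSl2.restrictPlus q c₀ T),
          LinearMap.ker (traceForm (QSl2.restrictPlus q c₀ T)) = ⊥,
          LinearMap.ker (traceForm (QSl2.restrictPlus q c₀ T)).flip = ⊥,
          ¬ HasFiniteDimensionalRep (QSl2.A q c₀)]) ∧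
    ∃ S : Set ℂ, S.Countable ∧ ∀ c₀ : ℂ, c₀ ∉ S →
      ∀ T, QSl2.IsInvariantTrace q c₀ T →
        IsNondegenerateOn (QSl2.filt q c₀) (QSl2.restrictPlus q c₀ T) ∧
        GivesNondegenerateShortStar (R := QSl2.APlus q c₀) (QSl2.filt q c₀) (QSl2.restrictPlus q c₀ T) := by
  refine ⟨fun c₀ => ⟨QSl2.exists_isInvariantTrace hq c₀, fun T hT => ⟨hT.1.isAdInvariant,
    fun T' hT' => hT.exists_smul hq hT', QSl2.tfae_nondegenerate hq hT⟩⟩,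
    -- The exceptional set S is the set of c₀ for which 𝒜 has a nonzero finite-dimensional
    -- representation.
    _, QSl2.countable_hasFiniteDimensionalRep hq, fun c₀ hc₀ T hT => ?_⟩
  have h := QSl2.isNondegenerateOn_of_not_hasFiniteDimensionalRep hq hT hc₀
  exact ⟨h, (QSl2.isOrthogonalizable hq hT h).givesNondegenerateShortStar⟩
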